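/- Let $1\le m<d$ be integers and let $c,t,\lambda>0$. For $\alpha,\beta>0$ let $E_{\alpha,\beta}(x)=\sum_{k\ge 0}\frac{x^k}{\Gamma(\alpha k+\beta)}$ be the two-parameter Mittag-Leffler function. A random flight in $\mathbb{R}^d$ at time $t$ starts at the origin, moves with speed $c$ and changes direction $N$ times in $[0,t]$, where $N$ is random; its position at time $t$ is $c\sum_{j=1}^{N+1}\tau_jV_j$. Here, given $N=n$, the durations $(\tau_1,\dots,\tau_n)$ and the directions $V_1,\dots,V_{n+1}$ are independent, the $V_j$ are independent and uniformly distributed on the unit sphere of $\mathbb{R}^d$, $\tau_{n+1}=t-\sum_{j=1}^n\tau_j$, and $(\tau_1,\dots,\tau_n)$ has the rescaled Dirichlet density with parameter $a>0$, $$\frac{\Gamma((n+1)a)}{\Gamma(a)^{n+1}}\,\frac{1}{t^{(n+1)a-1}}\prod_{j=1}^{n+1}\tau_j^{a-1},\qquad \tau_1,\dots,\tau_{n}>0,\ \sum_{j=1}^n\tau_j<t$$ (for $n=0$: $\tau_1=t$). (i) Let $\underline{\mathbf X}_d(t)$ be the position for $a=d-1$ and $P\{N=n\}=\frac{1}{E_{\frac{d-1}{2},\frac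 d2}(\lambda t)}\frac{(\lambda t)^n}{\Gamma(\frac{d-1}{2}n+\frac d2)}$, $n=0,1,\dots$ Then the law of the projection $\underline{\mathbf X}^d_m(t)=(X_1(t),\dots,X_m(t))$ onto $\mathbb{R}^m$ is absolutely continuous (the part of the law of $\underline{\mathbf X}_d(t)$ that is carried by the sphere of radius $ct$ is included), with density $$\frac{(c^2t^2-\|\underline{\mathbf x}_m\|^2)^{\frac{d-m}{2}-1}}{\pi^{\frac m2}(ct)^{d-2}}\;\frac{E_{\frac{d-1}{2},\frac{d-m}{2}}\!\left(\frac{\lambda t\,(c^2t^2-\|\underline{\mathbf x}_m\|^2)^{\frac{d-1}{2}}}{(ct)^{d-1}}\right)}{E_{\frac{d-1}{2},\frac d2}(\lambda t)}$$ for $\|\underline{\mathbf x}_m\|<ct$, and $0$ otherwise. (ii) Let $d\ge 3$ and let $\underline{\mathbf Y}_d(t)$ be the position for $a=\frac d2-1$ and $P\{N=n\}=\frac{1}{E_{\frac d2-1,\frac d2}(\lambda t)}\frac{(\lambda t)^n}{\Gamma((\frac d2-1)n+\frac d2)}$, $n=0,1,\dots$ Then the law of the projection $\underline{\mathbf Y}^d_m(t)=(Y_1(t),\dots,Y_m(t))$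 onto $\mathbb{R}^m$ is absolutely continuous, with density $$\frac{(c^2t^2-\|\underline{\mathbf y}_m\|^2)^{\frac{d-m}{2}-1}}{\pi^{\frac m2}(ct)^{d-2}}\;\frac{E_{\frac d2-1,\frac{d-m}{2}}\!\left(\frac{\lambda t\,(c^2t^2-\|\underline{\mathbf y}_m\|^2)^{\frac d2-1}}{(ct)^{d-2}}\right)}{E_{\frac d2-1,\frac d2}(\lambda t)}$$ for $\|\underline{\mathbf y}_m\|<ct$, and $0$ otherwise. -/

import Mathlib

open MeasureTheory ProbabilityTheory

noncomputable section

/-- The two-parameter Mittag-Leffler function `E_{α,β}(x) = ∑ₖ xᵏ / Γ(α k + β)`. -/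
def mittagLeffler (α β x : ℝ) : ℝ :=
  ∑' k : ℕ, x ^ k / Real.Gamma (α * k + β)

/-- The point probabilities `(1 / E_{α,β}(l t)) (l t)ⁿ / Γ(α n + β)`, `n = 0, 1, …`, of the
fractional Poisson process with rate `l` and parameters `α, β` at time `t`. -/
def fracPoissonProb (α β l t : ℝ) (n : ℕ) : ℝ :=
  1 / mittagLeffler α β (l * t) * ((l * t) ^ n / Real.Gamma (α * n + β))

/-- The joint law of `(τ₁, …, τₙ)`, where `(τ₁, …, τₙ, τₙ₊₁)`, with `τₙ₊₁ = t - (τ₁ + ⋯ + τₙ)`,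
has the Dirichlet distribution with all `n + 1` parameters equal to `a`, rescaled to total
length `t`. For `n = 0` this is the unit mass at the empty vector, so that `τ₁ = t`. -/
def dirichletSteps (a t : ℝ) (n : ℕ) : Measure (Fin n → ℝ) :=
  open scoped Classical in
  volume.withDensity fun s =>
    ENNReal.ofReal
      (if (∀ j, 0 < s j) ∧ ∑ j, s j < t then
        Real.Gamma ((n + 1) * a) / Real.Gamma a ^ (n + 1) * (1 / t ^ ((n + 1) * a - 1)) *
          ((∏ j, s j ^ (a - 1)) * (t - ∑ j, s j) ^ (a - 1))
      else 0)

/-- The uniform distribution on the unit sphere of `ℝᵈ`: normalized surface measure. -/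
def uniformSphere (d : ℕ) : Measure (Metric.sphere (0 : EuclideanSpace ℝ (Fin d)) 1) :=
  ((volume : Measure (EuclideanSpace ℝ (Fin d))).toSphere Set.univ)⁻¹ •
    (volume : Measure (EuclideanSpace ℝ (Fin d))).toSphere

/-- The random variables `N` (number of changes of direction up to time `t`), `τ j` (duration of
the displacement number `j`, counted from `0`, for `j < N`) and `V j` (direction of the
displacement number `j`, for `j ≤ N`) describe at time `t` an isotropic random flight in `ℝᵈ`
whose number of changes of direction has the point probabilities `p n` and whose displacements
have durations with Dirichlet parameter `a`.

The number `N`, the durations and the directions are independent. As the number of durations and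
of directions depends on `N`, this is expressed by their joint conditional law given `N = n`: the
product of the rescaled Dirichlet law of the first `n` durations (the last duration is the
remaining time) and of `n + 1` copies of the uniform law on the unit sphere. -/
structure IsRandomFlight {Ω : Type*} [MeasurableSpace Ω] (P : Measure Ω) (d : ℕ) (a t : ℝ)
    (p : ℕ → ℝ) (N : Ω → ℕ) (τ : ℕ → Ω → ℝ)
    (V : ℕ → Ω → Metric.sphere (0 : EuclideanSpace ℝ (Fin d)) 1) : Prop where
  measurable_number : Measurable N
  measurable_duration : ∀ j, Measurable (τ j)
  measurable_direction : ∀ j, Measurable (V j)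
  number_law : ∀ n, P (N ⁻¹' {n}) = ENNReal.ofReal (p n)
  conditional_law : ∀ n,
    (ProbabilityTheory.cond P (N ⁻¹' {n})).map
        (fun ω => ((fun j : Fin n => τ j ω), (fun j : Fin (n + 1) => V j ω))) =
      (dirichletSteps a t n).prod (Measure.pi fun _ : Fin (n + 1) => uniformSphere d)

/-- The duration of the displacement number `j ≤ n` (counted from `0`) when there are `n` changes
of direction up to time `t`: the last displacement takes the remaining time. -/
def stepDuration {Ω : Type*} (t : ℝ) (τ : ℕ → Ω → ℝ) (n j : ℕ) (ω : Ω) : ℝ :=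
  if j < n then τ j ω else t - ∑ i ∈ Finset.range n, τ i ω

/-- The position at time `t` of the random flight with speed `c` that starts at the origin. -/
def flightPosition {Ω : Type*} {d : ℕ} (c t : ℝ) (N : Ω → ℕ) (τ : ℕ → Ω → ℝ)
    (V : ℕ → Ω → Metric.sphere (0 : EuclideanSpace ℝ (Fin d)) 1) (ω : Ω) :
    EuclideanSpace ℝ (Fin d) :=
  c • ∑ j ∈ Finset.range (N ω + 1),
    stepDuration t τ (N ω) j ω • (V j ω : EuclideanSpace ℝ (Fin d))

/-- The projection of `ℝᵈ` onto the first `m` coordinates. -/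
def projFirst {d m : ℕ} (h : m ≤ d) (x : EuclideanSpace ℝ (Fin d)) : EuclideanSpace ℝ (Fin m) :=
  WithLp.toLp 2 fun i => x (Fin.castLE h i)

/-- The probability density of the projection onto `ℝᵐ` of the flight in `ℝᵈ` with Dirichlet
parameter `d - 1`; it vanishes outside the open ball of radius `c t`. -/
def projDensityX (d m : ℕ) (c t l : ℝ) (x : EuclideanSpace ℝ (Fin m)) : ℝ :=
  open scoped Classical in
  if ‖x‖ < c * t then
    (c ^ 2 * t ^ 2 - ‖x‖ ^ 2) ^ (((d : ℝ) - m) / 2 - 1) /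
        (Real.pi ^ ((m : ℝ) / 2) * (c * t) ^ ((d : ℝ) - 2)) *
      (mittagLeffler (((d : ℝ) - 1) / 2) (((d : ℝ) - m) / 2)
          (l * t * (c ^ 2 * t ^ 2 - ‖x‖ ^ 2) ^ (((d : ℝ) - 1) / 2) / (c * t) ^ ((d : ℝ) - 1)) /
        mittagLeffler (((d : ℝ) - 1) / 2) ((d : ℝ) / 2) (l * t))
  else 0

/-- The probability density of the projection onto `ℝᵐ` of the flight in `ℝᵈ` with Dirichlet
parameter `d / 2 - 1`; it vanishes outside the open ball of radius `c t`. -/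
def projDensityY (d m : ℕ) (c t l : ℝ) (y : EuclideanSpace ℝ (Fin m)) : ℝ :=
  open scoped Classical in
  if ‖y‖ < c * t then
    (c ^ 2 * t ^ 2 - ‖y‖ ^ 2) ^ (((d : ℝ) - m) / 2 - 1) /
        (Real.pi ^ ((m : ℝ) / 2) * (c * t) ^ ((d : ℝ) - 2)) *
      (mittagLeffler ((d : ℝ) / 2 - 1) (((d : ℝ) - m) / 2)
          (l * t * (c ^ 2 * t ^ 2 - ‖y‖ ^ 2) ^ ((d : ℝ) / 2 - 1) / (c * t) ^ ((d : ℝ) - 2)) /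
        mittagLeffler ((d : ℝ) / 2 - 1) ((d : ℝ) / 2) (l * t))
  else 0

end

/-!
The law of the projection is found by the method of moments.

Condition on `N = n`, let `f` be a linear form on `ℝᵐ`, extended to `ℝᵈ`, and put `A = (n + 1) a`.
The mixed moments of a Dirichlet law are quotients of rising factorials, so the multinomial
expansion of `(∑ τⱼ ⟨f, Vⱼ⟩) ^ p` shows that `(A)_p / p!` times its expectation is, up to powers
of `c t`, the coefficient of `zᵖ` in the `n + 1`-st power of `E (1 - z ⟨f, V⟩) ^ (-a)`
(`integral_inner_pathEnd_pow`). The even moments of a coordinate of `V` are `(1/2)_q / (d/2)_q`, and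
for the two parameters of the theorem and `‖f‖ = 1` the generating function is
`(1 - z²) ^ (-(d - 1) / 2)` for `a = d - 1`, and `((1 + √(1 - z²)) / 2) ^ (1 - d / 2)` for
`a = d / 2 - 1`. Its powers have explicit coefficients. In both cases this is the Rothe–Hagen identity
(`rothe_convolution`), which is packaged as `IsDirichletSemigroup`: the `n + 1`-st power is again of
the form `E (1 - z U) ^ (-A)`, where `U` has the even moments `(1/2)_q / (δ A)_q`.

These are the moments of `⟨f, x⟩` under the density proportional to
`(R² - ‖x‖²) ^ (κ - 1)` on the ball of radius `R = c t` in `ℝᵐ`, where `κ + m / 2 = δ A`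
(`integral_inner_pow_mul_ballProfile`). A bounded law is determined by the moments of
its linear forms (`ext_of_moments`), which identifies the conditional law (`map_projFirst_pathEnd`);
the case `n = 0`, where the flight ends on the sphere, needs no separate treatment. Finally, the
mixture of these densities with the fractional Poisson weights is a Mittag-Leffler series
(`tsum_fracPoissonProb_mul_ballProfile`).
-/

noncomputable section

/-! ### Rising factorials and the Rothe–Hagen identity -/

/-- The rising factorial `x (x + 1) ⋯ (x + n - 1)`. -/
abbrev rising (x : ℝ) (n : ℕ) : ℝ := (ascPochhammer ℝ n).eval x

lemma rising_succ (x : ℝ) (n : ℕ) : rising x (n + 1) = rising x n * (x + n) :=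
  ascPochhammer_succ_eval n x

lemma rising_succ_left (x : ℝ) (n : ℕ) : rising x (n + 1) = x * rising (x + 1) n := by
  simp [rising, ascPochhammer_succ_left]

lemma rising_pos {x : ℝ} (hx : 0 < x) (n : ℕ) : 0 < rising x n := ascPochhammer_pos n x hx

lemma rising_add (x : ℝ) (m n : ℕ) : rising x (m + n) = rising x m * rising (x + m) n := by
  simp [rising, ← ascPochhammer_mul]

lemma Gamma_add_natCast {x : ℝ} (hx : 0 < x) (n : ℕ) :
    Real.Gamma (x + n) = rising x n * Real.Gamma x := by
  induction n with
  | zero => simp [rising]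
  | succ n ih =>
    rw [Nat.cast_succ, ← add_assoc, Real.Gamma_add_one (by positivity), ih, rising_succ]
    ring

/-- The duplication formula for rising factorials. -/
lemma rising_two_mul (x : ℝ) (n : ℕ) :
    rising x (2 * n) = 4 ^ n * rising (x / 2) n * rising ((x + 1) / 2) n := by
  induction n with
  | zero => simp [rising]
  | succ n ih =>
    rw [show 2 * (n + 1) = 2 * n + 1 + 1 by ring, rising_succ, rising_succ, ih, rising_succ,
      rising_succ]
    push_cast
    ring

/-- The Rothe polynomial `r (r + η k + 1) ⋯ (r + η k + k - 1) / k!` in `r`, read as `1` for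
`k = 0`. It is the coefficient of `zᵏ` in `B(z) ^ r`, where the power series `B` solves
`B = 1 + z B ^ (η + 1)`. -/
def rothe (η : ℝ) : ℕ → Polynomial ℝ
  | 0 => 1
  | k + 1 => Polynomial.C (((k + 1).factorial : ℝ)⁻¹) * (Polynomial.X *
      (ascPochhammer ℝ k).comp (Polynomial.X + Polynomial.C (η * (k + 1) + 1)))

lemma rothe_zero_eval (η r : ℝ) : (rothe η 0).eval r = 1 := by simp [rothe]

lemma rothe_succ_eval (η r : ℝ) (k : ℕ) :
    (rothe η (k + 1)).eval r =
      r * rising (r + (η * (k + 1) + 1)) k / (k + 1).factorial := by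
  simp [rothe, rising]; ring

/-- The coefficientwise form of `B ^ (r + 1) = B ^ r + z B ^ (r + η + 1)`. -/
lemma rothe_step (η r : ℝ) (k : ℕ) :
    (rothe η (k + 1)).eval (r + 1) =
      (rothe η (k + 1)).eval r + (rothe η k).eval (r + (η + 1)) := by
  rw [rothe_succ_eval, rothe_succ_eval]
  cases k with
  | zero => simp [rising, rothe]
  | succ k =>
    rw [rothe_succ_eval, rising_succ,
      show r + (η * (((k + 1 : ℕ) : ℝ) + 1) + 1) = r + η * (k + 2) + 1 by push_cast; ring,
      rising_succ_left,
      show r + 1 + (η * (((k + 1 : ℕ) : ℝ) + 1) + 1) = r + η * (k + 2) + 1 + 1 by push_cast; ring,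
      show r + (η + 1) + (η * ((k : ℝ) + 1) + 1) = r + η * (k + 2) + 1 + 1 by ring,
      Nat.factorial_succ (k + 1)]
    have h : ((k + 1).factorial : ℝ) ≠ 0 := by positivity
    have h2 : ((k : ℝ) + 2) ≠ 0 := by positivity
    push_cast
    have h3 : ((k : ℝ) + 1 + 1) ≠ 0 := by positivity
    field_simp
    ring

/-- The Rothe–Hagen identity `B ^ r * B ^ s = B ^ (r + s)`. -/
lemma rothe_convolution (η r s : ℝ) (p : ℕ) :
    ∑ x ∈ Finset.HasAntidiagonal.antidiagonal p, (rothe η x.1).eval r * (rothe η x.2).eval s =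
      (rothe η p).eval (r + s) := by
  induction p generalizing r with
  | zero => simp [rothe]
  | succ p ih =>
    -- The difference of the two sides is a polynomial in `r` that is invariant under `r ↦ r + 1`
    -- and vanishes at `0`.
    let D : Polynomial ℝ := (∑ x ∈ Finset.HasAntidiagonal.antidiagonal (p + 1),
      rothe η x.1 * Polynomial.C ((rothe η x.2).eval s)) -
        (rothe η (p + 1)).comp (Polynomial.X + Polynomial.C s)
    have hD : ∀ r, D.eval r = (∑ x ∈ Finset.HasAntidiagonal.antidiagonal (p + 1),
        (rothe η x.1).eval r * (rothe η x.2).eval s) - (rothe η (p + 1)).eval (r + s) := by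
      intro r
      simp [D, Polynomial.eval_finsetSum]
    have hstep : ∀ r, D.eval (r + 1) = D.eval r := by
      intro r
      rw [hD, hD, Finset.Nat.sum_antidiagonal_succ, Finset.Nat.sum_antidiagonal_succ]
      simp only [rothe_step, rothe_zero_eval, add_mul, Finset.sum_add_distrib]
      rw [ih (r + (η + 1)), show r + 1 + s = r + s + 1 by ring, rothe_step,
        show r + (η + 1) + s = r + s + (η + 1) by ring]
      ring
    have hzero : ∀ n : ℕ, D.eval (n : ℝ) = 0 := by
      intro n
      induction n with
      | zero =>
        rw [hD, Finset.Nat.sum_antidiagonal_succ]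
        simp [rothe_succ_eval, rothe_zero_eval]
      | succ n ihn => rw [Nat.cast_succ, hstep, ihn]
    have hD0 : D = 0 := Polynomial.eq_zero_of_infinite_isRoot D <|
      (Set.infinite_range_of_injective (Nat.cast_injective (R := ℝ))).mono <| by
        rintro _ ⟨n, rfl⟩
        exact hzero n
    have := hD r
    rw [hD0, Polynomial.eval_zero] at this
    linarith

/-- The moments of a coordinate of a random vector with a certain rotation invariant law: odd moments
vanish and the moment of order `2 q` is `(1/2)_q / (δ)_q`. For `δ = d / 2` this is the uniform law on the unit
sphere of `ℝᵈ`; other values of `δ` belong to Beta type laws on the unit ball. -/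
def radialMoment (δ : ℝ) (p : ℕ) : ℝ :=
  if Even p then rising (1 / 2) (p / 2) / rising δ (p / 2) else 0

/-- The coefficient of `zᵖ` in the expectation of `(1 - z U) ^ (-r)`, for a variable `U` with
moments `radialMoment δ`. -/
def dirichletCoeff (r δ : ℝ) (p : ℕ) : ℝ := rising r p / p.factorial * radialMoment δ p

lemma dirichletCoeff_odd (r δ : ℝ) {p : ℕ} (hp : ¬ Even p) : dirichletCoeff r δ p = 0 := by
  simp [dirichletCoeff, radialMoment, hp]

lemma factorial_two_mul_eq (q : ℕ) :
    ((2 * q).factorial : ℝ) = 4 ^ q * rising (1 / 2) q * q.factorial := by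
  have h := rising_two_mul 1 q
  rw [show ((1 : ℝ) + 1) / 2 = 1 by norm_num, rising, ascPochhammer_eval_one, rising,
    rising, ascPochhammer_eval_one] at h
  exact h

lemma dirichletCoeff_even (r δ : ℝ) (q : ℕ) :
    dirichletCoeff r δ (2 * q) =
      rising (r / 2) q * rising ((r + 1) / 2) q / (q.factorial * rising δ q) := by
  have h1 : rising (1 / 2) q ≠ 0 := (rising_pos (by norm_num) q).ne'
  have h2 : (q.factorial : ℝ) ≠ 0 := by positivity
  rw [dirichletCoeff, radialMoment, if_pos (even_two_mul q), factorial_two_mul_eq, rising_two_mul,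
    show 2 * q / 2 = q by omega]
  field_simp

lemma sum_antidiagonal_of_even {f g : ℕ → ℝ} (hf : ∀ p, ¬ Even p → f p = 0)
    (hg : ∀ p, ¬ Even p → g p = 0) (q : ℕ) :
    ∑ x ∈ Finset.HasAntidiagonal.antidiagonal (2 * q), f x.1 * g x.2 =
      ∑ x ∈ Finset.HasAntidiagonal.antidiagonal q, f (2 * x.1) * g (2 * x.2) := by
  symm
  refine Finset.sum_of_injOn (fun x => (2 * x.1, 2 * x.2)) ?_ ?_ ?_ ?_
  · intro x _ y _ h
    simp only [Prod.mk.injEq] at h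
    ext <;> omega
  · intro x hx
    simp only [Finset.mem_coe, Finset.HasAntidiagonal.mem_antidiagonal] at hx ⊢
    omega
  · rintro ⟨i, j⟩ hx hn
    by_cases hi : Even i
    · by_cases hj : Even j
      · obtain ⟨i, rfl⟩ := hi
        obtain ⟨j, rfl⟩ := hj
        refine absurd ⟨(i, j), ?_, ?_⟩ hn
        · simp only [Finset.mem_coe, Finset.HasAntidiagonal.mem_antidiagonal] at hx ⊢
          omega
        · simp only [Prod.mk.injEq]
          omega
      · simp [hg j hj]
    · simp [hf i hi]
  · intro x _
    rfl

lemma sum_antidiagonal_of_odd {f g : ℕ → ℝ} (hf : ∀ p, ¬ Even p → f p = 0)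
    (hg : ∀ p, ¬ Even p → g p = 0) {p : ℕ} (hp : ¬ Even p) :
    ∑ x ∈ Finset.HasAntidiagonal.antidiagonal p, f x.1 * g x.2 = 0 := by
  refine Finset.sum_eq_zero fun x hx => ?_
  rw [Finset.HasAntidiagonal.mem_antidiagonal] at hx
  by_cases hi : Even x.1
  · by_cases hj : Even x.2
    · exact absurd (hx ▸ hi.add hj) hp
    · rw [hg _ hj, mul_zero]
  · rw [hf _ hi, zero_mul]

/-- The semigroup property behind the explicit laws of the flights: `(1 - z U) ^ (-r)` has
expectations that multiply when `r` is added, where the law of `U` depends on `r` through `δ r`. -/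
def IsDirichletSemigroup (δ : ℝ → ℝ) : Prop :=
  ∀ r s : ℝ, 0 < r → 0 < s → ∀ p : ℕ,
    ∑ x ∈ Finset.HasAntidiagonal.antidiagonal p,
      dirichletCoeff r (δ r) x.1 * dirichletCoeff s (δ s) x.2 =
      dirichletCoeff (r + s) (δ (r + s)) p

/-- Odd coefficients vanish, so it is enough that the even ones are Rothe polynomials, up to a
scaling of `z²` and of `r`. -/
lemma isDirichletSemigroup_of_rothe {δ : ℝ → ℝ} (η θ ρ : ℝ)
    (h : ∀ r : ℝ, 0 < r → ∀ q : ℕ, dirichletCoeff r (δ r) (2 * q) =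
      ρ ^ q * (rothe η q).eval (θ * r)) : IsDirichletSemigroup δ := by
  intro r s hr hs p
  have hr' := fun p => dirichletCoeff_odd r (δ r) (p := p)
  have hs' := fun p => dirichletCoeff_odd s (δ s) (p := p)
  by_cases hp : Even p
  · obtain ⟨q, rfl⟩ := even_iff_exists_two_mul.mp hp
    rw [sum_antidiagonal_of_even hr' hs', h _ (add_pos hr hs), mul_add, ← rothe_convolution,
      Finset.mul_sum]
    refine Finset.sum_congr rfl fun x hx => ?_
    rw [Finset.HasAntidiagonal.mem_antidiagonal] at hx
    rw [h r hr, h s hs, ← hx, pow_add]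
    ring
  · rw [sum_antidiagonal_of_odd hr' hs' hp, dirichletCoeff_odd _ _ hp]

/-- For `δ r = (r + 1) / 2` the generating function is `(1 - z²) ^ (-r / 2)`. -/
lemma isDirichletSemigroup_half : IsDirichletSemigroup fun r => (r + 1) / 2 := by
  refine isDirichletSemigroup_of_rothe 0 (1 / 2) 1 fun r hr q => ?_
  have h : rising ((r + 1) / 2) q ≠ 0 := (rising_pos (by positivity) q).ne'
  rw [dirichletCoeff_even]
  cases q with
  | zero => simp [rising, rothe]
  | succ q =>
    rw [rothe_succ_eval, rising_succ_left (r / 2)]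
    simp only [one_pow, one_mul, zero_mul, zero_add, show 1 / 2 * r = r / 2 by ring]
    field_simp

/-- For `δ r = r + 1` the generating function is `((1 + √(1 - z²)) / 2) ^ (-r)`. -/
lemma isDirichletSemigroup_one : IsDirichletSemigroup fun r => r + 1 := by
  refine isDirichletSemigroup_of_rothe 1 1 (1 / 4) fun r hr q => ?_
  have h : rising (r + 1) q ≠ 0 := (rising_pos (by positivity) q).ne'
  have h2 := rising_two_mul r q
  rw [dirichletCoeff_even]
  cases q with
  | zero => simp [rising, rothe]
  | succ q =>
    rw [rothe_succ_eval]
    have h3 : rising r (2 * (q + 1)) =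
        r * (rising (r + 1) (q + 1) * rising (r + 1 + ((q + 1 : ℕ) : ℝ)) q) := by
      rw [← rising_add, ← rising_succ_left]
      congr 1
      ring
    rw [h3] at h2
    rw [show 1 * r + (1 * ((q : ℝ) + 1) + 1) = r + 1 + ((q + 1 : ℕ) : ℝ) by push_cast; ring,
      div_pow, one_pow]
    have h4 : ((q + 1).factorial : ℝ) ≠ 0 := by positivity
    field_simp
    linarith

/-- The semigroup property iterated: the `n + 1`-fold convolution of the coefficients. -/
lemma IsDirichletSemigroup.sum_piAntidiag {δ : ℝ → ℝ} (h : IsDirichletSemigroup δ) {a : ℝ}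
    (ha : 0 < a) (n p : ℕ) :
    ∑ k ∈ Finset.piAntidiag (Finset.univ : Finset (Fin (n + 1))) p,
        ∏ j, dirichletCoeff a (δ a) (k j) =
      dirichletCoeff ((n + 1) * a) (δ ((n + 1) * a)) p := by
  have key : ∀ (n : ℕ), PowerSeries.mk (dirichletCoeff a (δ a)) ^ (n + 1) =
      PowerSeries.mk (dirichletCoeff ((n + 1) * a) (δ ((n + 1) * a))) := by
    intro n
    induction n with
    | zero => simp
    | succ n ih =>
      rw [pow_succ, ih]
      ext p
      rw [PowerSeries.coeff_mul]
      simp only [PowerSeries.coeff_mk]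
      rw [h _ _ (by positivity) ha]
      congr 2 <;> push_cast <;> ring_nf
  have h2 := congrArg (PowerSeries.coeff p) (key n)
  rw [PowerSeries.coeff_mk] at h2
  rw [← h2, show PowerSeries.mk (dirichletCoeff a (δ a)) ^ (n + 1) =
    ∏ _j : Fin (n + 1), PowerSeries.mk (dirichletCoeff a (δ a)) by simp, PowerSeries.coeff_prod]
  simp only [PowerSeries.coeff_mk]
  refine Finset.sum_bij' (fun k _ => Finsupp.equivFunOnFinite.symm k) (fun l _ => ⇑l) ?_ ?_ ?_ ?_ ?_
  · intro k hk
    simpa [Finset.mem_finsuppAntidiag] using hk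
  · intro l hl
    simpa [Finset.mem_finsuppAntidiag] using hl
  · intro k _
    rfl
  · intro l _
    ext
    rfl
  · intro k _
    rfl

/-! ### Moments of the Dirichlet law -/

/-- The Beta integral over `(0, t)`. -/
lemma integral_Ioo_rpow_mul_rpow {a b t : ℝ} (ha : 0 < a) (hb : 0 < b) (ht : 0 < t) :
    ∫ x in Set.Ioo 0 t, x ^ (a - 1) * (t - x) ^ (b - 1) =
      Real.Gamma a * Real.Gamma b / Real.Gamma (a + b) * t ^ (a + b - 1) := by
  have h := Complex.betaIntegral_scaled a b ht
  rw [Complex.betaIntegral_eq_Gamma_mul_div _ _ (by simpa) (by simpa),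
    intervalIntegral.integral_of_le ht.le, integral_Ioc_eq_integral_Ioo] at h
  have h2 : ∫ x in Set.Ioo 0 t, (x : ℂ) ^ ((a : ℂ) - 1) * ((t : ℂ) - x) ^ ((b : ℂ) - 1) =
      ∫ x in Set.Ioo 0 t, ((x ^ (a - 1) * (t - x) ^ (b - 1) : ℝ) : ℂ) := by
    refine setIntegral_congr_fun measurableSet_Ioo fun x hx => ?_
    rw [Complex.ofReal_mul, Complex.ofReal_cpow hx.1.le, Complex.ofReal_cpow (sub_pos.2 hx.2).le]
    push_cast
    rfl
  rw [h2, integral_complex_ofReal, ← Complex.ofReal_add, Complex.Gamma_ofReal,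
    Complex.Gamma_ofReal, Complex.Gamma_ofReal, ← Complex.ofReal_one, ← Complex.ofReal_sub,
    ← Complex.ofReal_cpow ht.le] at h
  rw [mul_comm]
  exact_mod_cast h

lemma lintegral_Ioo_rpow_mul_rpow {a b t : ℝ} (ha : 0 < a) (hb : 0 < b) (ht : 0 < t) :
    ∫⁻ x in Set.Ioo 0 t, ENNReal.ofReal (x ^ (a - 1) * (t - x) ^ (b - 1)) =
      ENNReal.ofReal (Real.Gamma a * Real.Gamma b / Real.Gamma (a + b) * t ^ (a + b - 1)) := by
  have hpos : 0 < Real.Gamma a * Real.Gamma b / Real.Gamma (a + b) * t ^ (a + b - 1) := by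
    positivity
  rw [← integral_Ioo_rpow_mul_rpow ha hb ht] at hpos ⊢
  rw [ofReal_integral_eq_lintegral_ofReal]
  · -- The integral of a function that is not integrable is `0`, and this one is positive.
    by_contra h
    rw [integral_undef h] at hpos
    exact lt_irrefl _ hpos
  · filter_upwards [ae_restrict_mem measurableSet_Ioo] with x hx
    exact mul_nonneg (Real.rpow_nonneg hx.1.le _) (Real.rpow_nonneg (sub_pos.2 hx.2).le _)

open scoped Classical in
/-- The unnormalized Dirichlet density with parameters `a` and `b` on the simplex of size `t`. -/
def dirichletKernel {n : ℕ} (a : Fin n → ℝ) (b t : ℝ) (s : Fin n → ℝ) : ℝ :=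
  if (∀ j, 0 < s j) ∧ ∑ j, s j < t then
    (∏ j, s j ^ (a j - 1)) * (t - ∑ j, s j) ^ (b - 1)
  else 0

lemma measurableSet_simplex (n : ℕ) (t : ℝ) :
    MeasurableSet {s : Fin n → ℝ | (∀ j, 0 < s j) ∧ ∑ j, s j < t} := by
  have h1 : MeasurableSet {s : Fin n → ℝ | ∀ j, 0 < s j} := by
    rw [Set.ofPred_forall]
    exact MeasurableSet.iInter fun j => measurableSet_lt measurable_const (measurable_pi_apply j)
  exact h1.inter
    (measurableSet_lt (f := fun s : Fin n → ℝ => ∑ j, s j) (by fun_prop) measurable_const)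

@[fun_prop]
lemma measurable_dirichletKernel {n : ℕ} (a : Fin n → ℝ) (b t : ℝ) :
    Measurable (dirichletKernel a b t) :=
  Measurable.ite (measurableSet_simplex n t) (f := fun s : Fin n → ℝ =>
    (∏ j, s j ^ (a j - 1)) * (t - ∑ j, s j) ^ (b - 1)) (by fun_prop) measurable_const

lemma dirichletKernel_nonneg {n : ℕ} (a : Fin n → ℝ) (b t : ℝ) (s : Fin n → ℝ) :
    0 ≤ dirichletKernel a b t s := by
  unfold dirichletKernel
  split_ifs with h
  · exact mul_nonneg (Finset.prod_nonneg fun j _ => Real.rpow_nonneg (h.1 j).le _)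
      (Real.rpow_nonneg (sub_pos.2 h.2).le _)
  · exact le_rfl

lemma dirichletKernel_cons {n : ℕ} (a : Fin (n + 1) → ℝ) (b t x : ℝ) (s : Fin n → ℝ) :
    dirichletKernel a b t (Fin.cons x s) =
      (Set.Ioo 0 t).indicator
        (fun x => x ^ (a 0 - 1) * dirichletKernel (Fin.tail a) b (t - x) s) x := by
  unfold dirichletKernel
  simp only [Fin.forall_fin_succ, Fin.sum_univ_succ, Fin.prod_univ_succ, Fin.cons_zero,
    Fin.cons_succ, Set.indicator_apply, Set.mem_Ioo, Fin.tail]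
  by_cases h : (0 < x ∧ ∀ j, 0 < s j) ∧ x + ∑ j, s j < t
  · have h0 : 0 ≤ ∑ j, s j := Finset.sum_nonneg fun j _ => (h.1.2 j).le
    rw [if_pos h, if_pos ⟨h.1.1, by linarith⟩, if_pos ⟨h.1.2, by linarith⟩, mul_assoc,
      sub_add_eq_sub_sub]
  · rw [if_neg h]
    by_cases hx : 0 < x ∧ x < t
    · rw [if_pos hx, if_neg, mul_zero]
      exact fun h' => h ⟨⟨hx.1, h'.1⟩, by linarith [h'.2]⟩
    · rw [if_neg hx]

/-- The Dirichlet integral. -/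
lemma lintegral_dirichletKernel {n : ℕ} (a : Fin n → ℝ) {b t : ℝ} (ha : ∀ j, 0 < a j)
    (hb : 0 < b) (ht : 0 < t) :
    ∫⁻ s, ENNReal.ofReal (dirichletKernel a b t s) =
      ENNReal.ofReal ((∏ j, Real.Gamma (a j)) * Real.Gamma b / Real.Gamma (∑ j, a j + b) *
        t ^ (∑ j, a j + b - 1)) := by
  induction n generalizing t with
  | zero =>
    have hΓ := (Real.Gamma_pos_of_pos hb).ne'
    rw [volume_pi, Measure.pi_of_empty _ Fin.elim0, lintegral_dirac]
    simp [dirichletKernel, ht, hΓ]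
  | succ n ih =>
    have hB : 0 < ∑ j, Fin.tail a j + b :=
      add_pos_of_nonneg_of_pos (Finset.sum_nonneg fun j _ => (ha _).le) hb
    have hsum : ∑ j, a j + b = a 0 + (∑ j, Fin.tail a j + b) := by
      rw [Fin.sum_univ_succ, add_assoc]; rfl
    have hprod : ∏ j, Real.Gamma (a j) = Real.Gamma (a 0) * ∏ j, Real.Gamma (Fin.tail a j) :=
      Fin.prod_univ_succ _
    have hP : 0 < ∏ j, Real.Gamma (Fin.tail a j) :=
      Finset.prod_pos fun j _ => Real.Gamma_pos_of_pos (ha _)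
    set C := (∏ j, Real.Gamma (Fin.tail a j)) * Real.Gamma b /
      Real.Gamma (∑ j, Fin.tail a j + b) with hC
    have hC0 : 0 ≤ C := by positivity
    have hmeas : Measurable fun z : ℝ × (Fin n → ℝ) =>
        ENNReal.ofReal (dirichletKernel a b t (Fin.cons z.1 z.2)) := by
      refine ENNReal.measurable_ofReal.comp ((measurable_dirichletKernel a b t).comp ?_)
      refine measurable_pi_iff.2 fun j => ?_
      refine Fin.cases ?_ (fun i => ?_) j
      · simpa using measurable_fst
      · simp only [Fin.cons_succ]
        fun_prop
    calc ∫⁻ s, ENNReal.ofReal (dirichletKernel a b t s)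
        = ∫⁻ z : ℝ × (Fin n → ℝ), ENNReal.ofReal (dirichletKernel a b t (Fin.cons z.1 z.2)) := by
          rw [← (volume_preserving_piFinSuccAbove (fun _ : Fin (n + 1) => ℝ) 0).symm.lintegral_comp
            (by fun_prop)]
          simp [MeasurableEquiv.piFinSuccAbove_symm_apply, Fin.insertNthEquiv]
      _ = ∫⁻ x, ∫⁻ s, ENNReal.ofReal (dirichletKernel a b t (Fin.cons x s)) :=
          lintegral_prod _ hmeas.aemeasurable
      _ = ∫⁻ x in Set.Ioo 0 t, ENNReal.ofReal C *
            ENNReal.ofReal (x ^ (a 0 - 1) * (t - x) ^ (∑ j, Fin.tail a j + b - 1)) := by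
          rw [← lintegral_indicator measurableSet_Ioo]
          refine lintegral_congr fun x => ?_
          simp only [dirichletKernel_cons]
          by_cases hx : x ∈ Set.Ioo 0 t
          · simp only [Set.indicator_of_mem hx]
            have h0 : 0 ≤ x ^ (a 0 - 1) := Real.rpow_nonneg hx.1.le _
            simp only [ENNReal.ofReal_mul h0]
            rw [lintegral_const_mul _ (by fun_prop),
              ih (Fin.tail a) (fun j => ha _) (sub_pos.2 hx.2), ← hC, ENNReal.ofReal_mul hC0]
            ring
          · simp [Set.indicator_of_notMem hx]
      _ = _ := by
          rw [lintegral_const_mul _ (by fun_prop), lintegral_Ioo_rpow_mul_rpow (ha 0) hB ht,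
            ← ENNReal.ofReal_mul hC0, hsum, hprod, hC]
          have := (Real.Gamma_pos_of_pos hB).ne'
          congr 1
          field_simp

lemma integral_dirichletKernel {n : ℕ} (a : Fin n → ℝ) {b t : ℝ} (ha : ∀ j, 0 < a j)
    (hb : 0 < b) (ht : 0 < t) :
    ∫ s, dirichletKernel a b t s =
      (∏ j, Real.Gamma (a j)) * Real.Gamma b / Real.Gamma (∑ j, a j + b) *
        t ^ (∑ j, a j + b - 1) := by
  have hP : 0 < ∏ j, Real.Gamma (a j) := Finset.prod_pos fun j _ => Real.Gamma_pos_of_pos (ha _)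
  have hB : 0 < ∑ j, a j + b :=
    add_pos_of_nonneg_of_pos (Finset.sum_nonneg fun j _ => (ha _).le) hb
  rw [integral_eq_lintegral_of_nonneg_ae (ae_of_all _ (dirichletKernel_nonneg a b t))
    (measurable_dirichletKernel a b t).aestronglyMeasurable, lintegral_dirichletKernel a ha hb ht,
    ENNReal.toReal_ofReal (by positivity)]

/-- The vector of all `n + 1` durations, obtained from the first `n` by appending the remaining time. -/
def allSteps {n : ℕ} (t : ℝ) (s : Fin n → ℝ) : Fin (n + 1) → ℝ := Fin.snoc s (t - ∑ j, s j)

@[simp] lemma allSteps_castSucc {n : ℕ} (t : ℝ) (s : Fin n → ℝ) (j : Fin n) :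
    allSteps t s j.castSucc = s j := by simp [allSteps]

@[simp] lemma allSteps_last {n : ℕ} (t : ℝ) (s : Fin n → ℝ) :
    allSteps t s (Fin.last n) = t - ∑ j, s j := by simp [allSteps]

@[fun_prop]
lemma measurable_allSteps (n : ℕ) (t : ℝ) :
    Measurable (allSteps t : (Fin n → ℝ) → Fin (n + 1) → ℝ) := by
  refine measurable_pi_iff.2 fun j => ?_
  refine Fin.lastCases ?_ (fun i => ?_) j
  · simp only [allSteps_last]
    fun_prop
  · simp only [allSteps_castSucc]
    fun_prop

/-- The density of `dirichletSteps`. -/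
lemma dirichletSteps_eq (a t : ℝ) (n : ℕ) :
    dirichletSteps a t n = volume.withDensity fun s => ENNReal.ofReal
      (Real.Gamma ((n + 1) * a) / Real.Gamma a ^ (n + 1) * (1 / t ^ ((n + 1) * a - 1)) *
        dirichletKernel (fun _ => a) a t s) := by
  unfold dirichletSteps dirichletKernel
  congr 1
  ext s
  congr 1
  split_ifs <;> simp

/-- The mixed moments of the Dirichlet law. -/
lemma integral_dirichletSteps {a t : ℝ} (ha : 0 < a) (ht : 0 < t) (n : ℕ) (k : Fin (n + 1) → ℕ) :
    ∫ s, ∏ j, allSteps t s j ^ k j ∂dirichletSteps a t n =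
      t ^ (∑ j, k j) * (∏ j, rising a (k j)) / rising ((n + 1) * a) (∑ j, k j) := by
  have hA : 0 < (n + 1) * a := by positivity
  set K := Real.Gamma ((n + 1) * a) / Real.Gamma a ^ (n + 1) * (1 / t ^ ((n + 1) * a - 1)) with hK
  have hK0 : 0 ≤ K := by positivity
  have hkey : ∀ s : Fin n → ℝ, dirichletKernel (fun _ => a) a t s * ∏ j, allSteps t s j ^ k j =
      dirichletKernel (fun j : Fin n => a + k j.castSucc) (a + k (Fin.last n)) t s := by
    intro s
    unfold dirichletKernel
    split_ifs with h
    · rw [Fin.prod_univ_castSucc]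
      simp only [allSteps_castSucc, allSteps_last]
      rw [mul_mul_mul_comm, ← Finset.prod_mul_distrib]
      congr 1
      · refine Finset.prod_congr rfl fun j _ => ?_
        rw [← Real.rpow_natCast, ← Real.rpow_add (h.1 j)]
        ring_nf
      · rw [← Real.rpow_natCast, ← Real.rpow_add (sub_pos.2 h.2)]
        ring_nf
    · rw [zero_mul]
  rw [dirichletSteps_eq, ← hK, integral_withDensity_eq_integral_toReal_smul
    (by fun_prop)
    (ae_of_all _ fun _ => ENNReal.ofReal_lt_top)]
  have h1 : ∀ s : Fin n → ℝ, (ENNReal.ofReal (K * dirichletKernel (fun _ => a) a t s)).toReal •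
      ∏ j, allSteps t s j ^ k j =
        K * dirichletKernel (fun j : Fin n => a + k j.castSucc) (a + k (Fin.last n)) t s := by
    intro s
    rw [ENNReal.toReal_ofReal (mul_nonneg hK0 (dirichletKernel_nonneg _ _ _ _)), smul_eq_mul,
      mul_assoc, hkey]
  simp only [h1]
  rw [integral_const_mul, integral_dirichletKernel _ (fun j => by positivity) (by positivity) ht]
  have h2 : ∑ j : Fin n, (a + k j.castSucc) + (a + k (Fin.last n)) =
      (n + 1) * a + ((∑ j, k j : ℕ) : ℝ) := by
    rw [Fin.sum_univ_castSucc, Finset.sum_add_distrib]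
    simp
    ring
  have h3 : (∏ j : Fin n, Real.Gamma (a + k j.castSucc)) * Real.Gamma (a + k (Fin.last n)) =
      (∏ j, rising a (k j)) * Real.Gamma a ^ (n + 1) := by
    rw [← Fin.prod_univ_castSucc (fun j => Real.Gamma (a + k j))]
    simp only [Gamma_add_natCast ha]
    rw [Finset.prod_mul_distrib]
    simp
  rw [h2, h3, Gamma_add_natCast hA, hK, add_sub_right_comm, Real.rpow_add ht, Real.rpow_natCast]
  have h4 := (Real.Gamma_pos_of_pos ha).ne'
  have h5 := (Real.Gamma_pos_of_pos hA).ne'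
  have h6 := (rising_pos hA (∑ j, k j)).ne'
  have h7 := (Real.rpow_pos_of_pos ht ((n + 1) * a - 1)).ne'
  field_simp

lemma integrable_dirichletSteps {a t : ℝ} (ha : 0 < a) (ht : 0 < t) (n : ℕ)
    (k : Fin (n + 1) → ℕ) :
    Integrable (fun s => ∏ j, allSteps t s j ^ k j) (dirichletSteps a t n) := by
  -- The integral of a function that is not integrable is `0`, and this one is positive.
  by_contra h
  have h1 := integral_dirichletSteps ha ht n k
  rw [integral_undef h] at h1
  have h2 : 0 < t ^ (∑ j, k j) * (∏ j, rising a (k j)) / rising ((n + 1) * a) (∑ j, k j) :=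
    div_pos (mul_pos (by positivity) (Finset.prod_pos fun j _ => rising_pos ha _))
      (rising_pos (by positivity) _)
  exact h2.ne h1

lemma isProbabilityMeasure_dirichletSteps {a t : ℝ} (ha : 0 < a) (ht : 0 < t) (n : ℕ) :
    IsProbabilityMeasure (dirichletSteps a t n) := by
  have h := integral_dirichletSteps ha ht n 0
  simp [rising] at h
  constructor
  rwa [← ENNReal.toReal_eq_one_iff]

lemma ae_dirichletSteps (a t : ℝ) (n : ℕ) :
    ∀ᵐ s ∂dirichletSteps a t n, (∀ j, 0 < s j) ∧ ∑ j, s j < t := by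
  rw [dirichletSteps_eq, ae_withDensity_iff (by fun_prop)]
  refine ae_of_all _ fun s hs => ?_
  by_contra h
  simp [dirichletKernel, h] at hs

/-! ### Moments of the uniform law on the sphere and of Beta type laws on the ball -/

/-- Integration in polar coordinates of a power of a linear form times a radial function. -/
lemma integral_inner_pow_mul_radial {d : ℕ} (hd : 0 < d) (f : EuclideanSpace ℝ (Fin d)) (p : ℕ)
    (h : ℝ → ℝ) :
    ∫ x : EuclideanSpace ℝ (Fin d), inner ℝ f x ^ p * h ‖x‖ =
      (∫ v : Metric.sphere (0 : EuclideanSpace ℝ (Fin d)) 1, inner ℝ f (v : EuclideanSpace ℝ (Fin d))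
        ^ p ∂(volume : Measure (EuclideanSpace ℝ (Fin d))).toSphere) *
      ∫ r in Set.Ioi (0 : ℝ), r ^ (p + d - 1) * h r := by
  have : Nonempty (Fin d) := ⟨⟨0, hd⟩⟩
  set μ := (volume : Measure (EuclideanSpace ℝ (Fin d)))
  calc ∫ x : EuclideanSpace ℝ (Fin d), inner ℝ f x ^ p * h ‖x‖ ∂μ
      = ∫ x : ({(0)}ᶜ : Set (EuclideanSpace ℝ (Fin d))),
          inner ℝ f (x : EuclideanSpace ℝ (Fin d)) ^ p * h ‖x.1‖ ∂(μ.comap (↑)) := by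
        rw [integral_subtype_comap (measurableSet_singleton _).compl
          fun x => inner ℝ f x ^ p * h ‖x‖, restrict_compl_singleton]
    _ = ∫ z : Metric.sphere (0 : EuclideanSpace ℝ (Fin d)) 1 × Set.Ioi (0 : ℝ),
          inner ℝ f (z.1 : EuclideanSpace ℝ (Fin d)) ^ p * ((z.2 : ℝ) ^ p * h z.2)
            ∂μ.toSphere.prod
              (.volumeIoiPow (Module.finrank ℝ (EuclideanSpace ℝ (Fin d)) - 1)) := by
        rw [← μ.measurePreserving_homeomorphUnitSphereProd.integral_comp
          (Homeomorph.measurableEmbedding _)]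
        refine integral_congr_ae (ae_of_all _ fun x => ?_)
        have hx : ‖x.1‖ ≠ 0 := norm_ne_zero_iff.2 x.2
        simp only [homeomorphUnitSphereProd_apply_fst_coe, homeomorphUnitSphereProd_apply_snd_coe,
          inner_smul_right]
        rw [← mul_assoc, ← mul_pow]
        congr 2
        field_simp
    _ = _ := by
        rw [integral_prod_mul (μ := μ.toSphere)
          (fun v => inner ℝ f (v : EuclideanSpace ℝ (Fin d)) ^ p)
          (fun r : Set.Ioi (0 : ℝ) => (r : ℝ) ^ p * h r)]
        congr 1
        simp only [Measure.volumeIoiPow, ENNReal.ofReal, finrank_euclideanSpace_fin]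
        rw [integral_withDensity_eq_integral_smul,
          integral_subtype_comap measurableSet_Ioi
            fun a => Real.toNNReal (a ^ (d - 1)) • (a ^ p * h a)]
        · refine setIntegral_congr_fun measurableSet_Ioi fun x hx => ?_
          rw [NNReal.smul_def, Real.coe_toNNReal _ (pow_nonneg hx.out.le _), smul_eq_mul,
            ← mul_assoc, ← pow_add]
          congr 2
          omega
        · exact (measurable_subtype_coe.pow_const _).real_toNNReal

/-- The moments of the one-dimensional Gaussian weight `exp (-x²)`. -/
def gaussWeightMoment (p : ℕ) : ℝ := ∫ x : ℝ, x ^ p * Real.exp (-x ^ 2)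

lemma integral_Ioi_pow_mul_exp_neg_sq (p : ℕ) :
    ∫ x in Set.Ioi (0 : ℝ), x ^ p * Real.exp (-x ^ 2) = Real.Gamma ((p + 1) / 2) / 2 := by
  have h := integral_rpow_mul_exp_neg_rpow (p := 2) (q := p) (by norm_num)
    (by linarith [(Nat.cast_nonneg p : (0 : ℝ) ≤ p)])
  rw [div_eq_inv_mul, ← one_div, ← h]
  refine setIntegral_congr_fun measurableSet_Ioi fun x _ => ?_
  norm_cast

lemma gaussWeightMoment_odd {p : ℕ} (hp : ¬ Even p) : gaussWeightMoment p = 0 := by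
  have h := integral_neg_eq_self (fun x : ℝ => x ^ p * Real.exp (-x ^ 2)) volume
  simp only [(Nat.not_even_iff_odd.1 hp).neg_pow, even_two.neg_pow, neg_mul, integral_neg] at h
  unfold gaussWeightMoment
  linarith

lemma gaussWeightMoment_even (q : ℕ) :
    gaussWeightMoment (2 * q) = Real.sqrt Real.pi * rising (1 / 2) q := by
  have h := integral_comp_abs (f := fun x : ℝ => x ^ (2 * q) * Real.exp (-x ^ 2))
  simp only [(even_two_mul q).pow_abs, sq_abs] at h
  rw [gaussWeightMoment, h, integral_Ioi_pow_mul_exp_neg_sq, mul_div_cancel₀ _ two_ne_zero,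
    ← Real.Gamma_one_half_eq, mul_comm (Real.Gamma _), ← Gamma_add_natCast (by norm_num)]
  congr 1
  push_cast
  ring

lemma exists_orthonormalBasis_direction {k : ℕ} (f : EuclideanSpace ℝ (Fin (k + 1))) :
    ∃ b : OrthonormalBasis (Fin (k + 1)) ℝ (EuclideanSpace ℝ (Fin (k + 1))), f = ‖f‖ • b 0 := by
  obtain ⟨e, he, hfe⟩ : ∃ e : EuclideanSpace ℝ (Fin (k + 1)), ‖e‖ = 1 ∧ f = ‖f‖ • e := by
    by_cases hf : f = 0
    · obtain ⟨e, he⟩ := exists_norm_eq (EuclideanSpace ℝ (Fin (k + 1))) zero_le_one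
      exact ⟨e, he, by simp [hf]⟩
    · have hf' : ‖f‖ ≠ 0 := norm_ne_zero_iff.2 hf
      exact ⟨‖f‖⁻¹ • f, by rw [norm_smul]; simp [hf'], by rw [smul_smul]; simp [hf']⟩
  obtain ⟨b, hb⟩ := Orthonormal.exists_orthonormalBasis_extension_of_card_eq
    (𝕜 := ℝ) (ι := Fin (k + 1)) (by simp) (v := fun _ => e) (s := {0}) <| by
      rw [orthonormal_iff_ite]
      intro i j
      rw [Subsingleton.elim i j]
      simp [he]
  exact ⟨b, by rw [hb 0 rfl, ← hfe]⟩

/-- In an orthonormal basis that starts with the direction of `f`, the integral is a product. -/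
lemma integral_inner_pow_mul_exp {k : ℕ} (f : EuclideanSpace ℝ (Fin (k + 1))) (p : ℕ) :
    ∫ x, inner ℝ f x ^ p * Real.exp (-‖x‖ ^ 2) =
      ‖f‖ ^ p * (gaussWeightMoment p * gaussWeightMoment 0 ^ k) := by
  obtain ⟨b, hb⟩ := exists_orthonormalBasis_direction f
  rw [← b.measurePreserving_repr_symm.integral_comp
      b.repr.symm.toHomeomorph.measurableEmbedding,
    ← (PiLp.volume_preserving_toLp (Fin (k + 1))).integral_comp
      (MeasurableEquiv.toLp 2 (Fin (k + 1) → ℝ)).measurableEmbedding]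
  have h1 : ∀ y : Fin (k + 1) → ℝ,
      inner ℝ f (b.repr.symm (WithLp.toLp 2 y)) ^ p *
        Real.exp (-‖b.repr.symm (WithLp.toLp 2 y)‖ ^ 2) =
      ‖f‖ ^ p * ∏ i, (y i ^ (if i = 0 then p else 0) * Real.exp (-y i ^ 2)) := by
    intro y
    have h2 : inner ℝ f (b.repr.symm (WithLp.toLp 2 y)) = ‖f‖ * y 0 := by
      conv_lhs => rw [hb]
      rw [inner_smul_left, ← b.repr_apply_apply]
      simp
    rw [h2, LinearIsometryEquiv.norm_map, EuclideanSpace.real_norm_sq_eq, Finset.prod_mul_distrib,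
      ← Real.exp_sum, Finset.sum_neg_distrib, mul_pow, mul_assoc]
    congr 2
    simp
  simp only [h1]
  rw [integral_const_mul, integral_fintype_prod_volume_eq_prod
    (f := fun i (x : ℝ) => x ^ (if i = 0 then p else 0) * Real.exp (-x ^ 2))]
  congr 1
  simp [Fin.prod_univ_succ, gaussWeightMoment]

/-- The total mass of the surface measure of the unit sphere of `ℝᵈ`. -/
def sphereMass (d : ℕ) : ℝ :=
  (volume : Measure (EuclideanSpace ℝ (Fin d))).toSphere.real Set.univ

/-- Both sides are the integral of `⟨f, x⟩ ^ p * exp (-‖x‖ ^ 2)`: polar coordinates give the left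
side, the product structure of the Gaussian weight the right side. -/
lemma integral_toSphere_inner_pow_mul {d : ℕ} (hd : 0 < d) (f : EuclideanSpace ℝ (Fin d)) (p : ℕ) :
    (∫ v : Metric.sphere (0 : EuclideanSpace ℝ (Fin d)) 1, inner ℝ f (v : EuclideanSpace ℝ (Fin d))
        ^ p ∂(volume : Measure (EuclideanSpace ℝ (Fin d))).toSphere) *
      (Real.Gamma (((p : ℝ) + d) / 2) / 2) =
      ‖f‖ ^ p * (gaussWeightMoment p * Real.sqrt Real.pi ^ (d - 1)) := by
  have h := integral_inner_pow_mul_radial hd f p fun r => Real.exp (-r ^ 2)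
  rw [integral_Ioi_pow_mul_exp_neg_sq] at h
  obtain ⟨k, rfl⟩ := Nat.exists_eq_succ_of_ne_zero hd.ne'
  have h0 : gaussWeightMoment 0 = Real.sqrt Real.pi := by
    simpa [rising] using gaussWeightMoment_even 0
  rw [integral_inner_pow_mul_exp, h0] at h
  rw [Nat.succ_sub_one, h]
  congr 4
  rw [show p + (k + 1) - 1 = p + k by omega]
  push_cast
  ring

lemma sphereMass_mul {d : ℕ} (hd : 0 < d) :
    sphereMass d * (Real.Gamma ((d : ℝ) / 2) / 2) = Real.sqrt Real.pi ^ d := by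
  have h := integral_toSphere_inner_pow_mul hd 0 0
  have h0 : gaussWeightMoment 0 = Real.sqrt Real.pi := by
    simpa [rising] using gaussWeightMoment_even 0
  simp only [pow_zero, integral_const, smul_eq_mul, mul_one, one_mul, Nat.cast_zero, zero_add,
    h0] at h
  rw [sphereMass, h, ← pow_succ']
  congr 1
  omega

lemma sphereMass_pos {d : ℕ} (hd : 0 < d) : 0 < sphereMass d := by
  have h := sphereMass_mul hd
  have h1 : (0 : ℝ) < d := by exact_mod_cast hd
  have h2 : 0 < Real.Gamma ((d : ℝ) / 2) / 2 := by positivity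
  have h3 : 0 < Real.sqrt Real.pi ^ d := by positivity
  rw [← h] at h3
  exact (pos_iff_pos_of_mul_pos h3).2 h2

/-- The moments of a linear form under the surface measure of the unit sphere. -/
lemma integral_toSphere_inner_pow {d : ℕ} (hd : 0 < d) (f : EuclideanSpace ℝ (Fin d)) (p : ℕ) :
    ∫ v : Metric.sphere (0 : EuclideanSpace ℝ (Fin d)) 1, inner ℝ f (v : EuclideanSpace ℝ (Fin d))
        ^ p ∂(volume : Measure (EuclideanSpace ℝ (Fin d))).toSphere =
      sphereMass d * (‖f‖ ^ p * radialMoment ((d : ℝ) / 2) p) := by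
  have h := integral_toSphere_inner_pow_mul hd f p
  have hm := sphereMass_mul hd
  have h1 : (0 : ℝ) < d := by exact_mod_cast hd
  have hΓ : Real.Gamma (((p : ℝ) + d) / 2) ≠ 0 := (Real.Gamma_pos_of_pos (by positivity)).ne'
  by_cases hp : Even p
  · obtain ⟨q, rfl⟩ := even_iff_exists_two_mul.mp hp
    have h2 : (((2 * q : ℕ) : ℝ) + d) / 2 = d / 2 + q := by push_cast; ring
    have h3 : Real.sqrt Real.pi * Real.sqrt Real.pi ^ (d - 1) = Real.sqrt Real.pi ^ d := by
      rw [← pow_succ']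
      congr 1
      omega
    rw [h2, Gamma_add_natCast (by positivity)] at h
    rw [gaussWeightMoment_even, mul_right_comm, h3, ← hm] at h
    have h4 := (rising_pos (x := (d : ℝ) / 2) (by positivity) q).ne'
    have h5 := (Real.Gamma_pos_of_pos (s := (d : ℝ) / 2) (by positivity)).ne'
    rw [radialMoment, if_pos hp, show 2 * q / 2 = q by omega]
    field_simp
    field_simp at h
    linarith
  · rw [gaussWeightMoment_odd hp] at h
    rw [radialMoment, if_neg hp]
    simp only [zero_mul, mul_zero] at h ⊢
    exact (mul_eq_zero.1 h).resolve_right (div_ne_zero hΓ two_ne_zero)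

lemma isProbabilityMeasure_uniformSphere {d : ℕ} (hd : 0 < d) :
    IsProbabilityMeasure (uniformSphere d) := by
  constructor
  rw [uniformSphere, Measure.smul_apply, smul_eq_mul]
  refine ENNReal.inv_mul_cancel (fun h => ?_) (measure_ne_top _ _)
  have := sphereMass_pos hd
  simp [sphereMass, Measure.real, h] at this

/-- The moments of a linear form under the uniform law on the unit sphere. -/
lemma integral_uniformSphere_inner_pow {d : ℕ} (hd : 0 < d) (f : EuclideanSpace ℝ (Fin d))
    (p : ℕ) :
    ∫ v, inner ℝ f (v : EuclideanSpace ℝ (Fin d)) ^ p ∂uniformSphere d =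
      ‖f‖ ^ p * radialMoment ((d : ℝ) / 2) p := by
  rw [uniformSphere, integral_smul_measure, integral_toSphere_inner_pow hd, ENNReal.toReal_inv,
    ← Measure.real, ← sphereMass, smul_eq_mul, inv_mul_cancel_left₀ (sphereMass_pos hd).ne']

/-- The radial profile of the Beta type density on the ball of radius `R` in `ℝᵐ`, proportional to
`(R² - r²) ^ (κ - 1)`. -/
def ballProfile (m : ℕ) (κ R r : ℝ) : ℝ :=
  (Set.Iio R).indicator (fun r => Real.Gamma (κ + m / 2) /
    (Real.pi ^ ((m : ℝ) / 2) * Real.Gamma κ * R ^ (2 * κ + m - 2)) *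
      (R ^ 2 - r ^ 2) ^ (κ - 1)) r

lemma ballProfile_nonneg (m : ℕ) {κ R r : ℝ} (hκ : 0 < κ) (hR : 0 < R) (hr : 0 ≤ r) :
    0 ≤ ballProfile m κ R r := by
  refine Set.indicator_apply_nonneg fun h => ?_
  have : 0 ≤ R ^ 2 - r ^ 2 := by nlinarith [h.out]
  positivity

@[fun_prop]
lemma measurable_ballProfile (m : ℕ) (κ R : ℝ) : Measurable (ballProfile m κ R) :=
  Measurable.indicator (by fun_prop) measurableSet_Iio

/-- A Beta integral, by the substitution `y = r ^ 2`. -/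
lemma integral_Ioi_pow_mul_ballProfile {m : ℕ} (hm : 0 < m) {κ R : ℝ} (hκ : 0 < κ) (hR : 0 < R)
    (q : ℕ) :
    ∫ r in Set.Ioi (0 : ℝ), r ^ (2 * q + m - 1) * ballProfile m κ R r =
      Real.Gamma (κ + m / 2) / (2 * Real.pi ^ ((m : ℝ) / 2)) * R ^ (2 * q) *
        (Real.Gamma (m / 2 + q) / Real.Gamma (κ + m / 2 + q)) := by
  have hm' : (0 : ℝ) < m := by exact_mod_cast hm
  set K := Real.Gamma (κ + m / 2) /
    (Real.pi ^ ((m : ℝ) / 2) * Real.Gamma κ * R ^ (2 * κ + m - 2)) with hK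
  let g : ℝ → ℝ := (Set.Ioo 0 (R ^ 2)).indicator
    fun y => y ^ ((m : ℝ) / 2 + q - 1) * (R ^ 2 - y) ^ (κ - 1)
  have hg : ∫ y in Set.Ioi (0 : ℝ), g y = Real.Gamma (m / 2 + q) * Real.Gamma κ /
      Real.Gamma (m / 2 + q + κ) * (R ^ 2) ^ ((m : ℝ) / 2 + q + κ - 1) := by
    rw [← integral_Ioo_rpow_mul_rpow (by positivity) hκ (by positivity),
      setIntegral_indicator measurableSet_Ioo,
      Set.inter_eq_self_of_subset_right fun x hx => hx.1]
  have h1 : ∀ r ∈ Set.Ioi (0 : ℝ), r ^ (2 * q + m - 1) * ballProfile m κ R r =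
      K / 2 * ((2 * r ^ ((2 : ℝ) - 1)) • g (r ^ (2 : ℝ))) := by
    intro r hr
    rw [Set.mem_Ioi] at hr
    by_cases hrR : r < R
    · have h2 : r ^ (2 : ℝ) ∈ Set.Ioo 0 (R ^ 2) := by
        rw [Real.rpow_two]
        exact ⟨by positivity, by nlinarith⟩
      rw [ballProfile, Set.indicator_of_mem (by exact hrR)]
      simp only [g]
      rw [Set.indicator_of_mem h2, ← Real.rpow_mul hr.le, Real.rpow_two, smul_eq_mul, ← hK]
      have h3 : r ^ (2 * q + m - 1) = r ^ ((2 : ℝ) - 1) * r ^ (2 * ((m : ℝ) / 2 + q - 1)) := by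
        rw [← Real.rpow_add hr, ← Real.rpow_natCast]
        congr 1
        rw [Nat.cast_sub (by omega)]
        push_cast
        ring
      rw [h3]
      ring
    · have h2 : r ^ (2 : ℝ) ∉ Set.Ioo 0 (R ^ 2) := by
        rw [Real.rpow_two]
        exact fun h => hrR (lt_of_pow_lt_pow_left₀ 2 hR.le h.2)
      rw [ballProfile, Set.indicator_of_notMem (by exact hrR)]
      simp only [g]
      rw [Set.indicator_of_notMem h2]
      simp
  rw [setIntegral_congr_fun measurableSet_Ioi h1, integral_const_mul,
    integral_comp_rpow_Ioi_of_pos (by norm_num), hg, hK, ← Real.rpow_natCast R 2,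
    ← Real.rpow_mul hR.le, show ((2 : ℕ) : ℝ) * ((m : ℝ) / 2 + q + κ - 1) =
      (2 * κ + m - 2) + ((2 * q : ℕ) : ℝ) by push_cast; ring, Real.rpow_add hR,
    Real.rpow_natCast, show (m : ℝ) / 2 + q + κ = κ + m / 2 + q by ring]
  have h4 := (Real.Gamma_pos_of_pos hκ).ne'
  have h5 := (Real.rpow_pos_of_pos hR (2 * κ + m - 2)).ne'
  field_simp

/-- The moments of a linear form under the Beta type law on the ball. -/
lemma integral_inner_pow_mul_ballProfile {m : ℕ} (hm : 0 < m) {κ R : ℝ} (hκ : 0 < κ)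
    (hR : 0 < R) (f : EuclideanSpace ℝ (Fin m)) (p : ℕ) :
    ∫ x, inner ℝ f x ^ p * ballProfile m κ R ‖x‖ =
      R ^ p * (‖f‖ ^ p * radialMoment (κ + m / 2) p) := by
  rw [integral_inner_pow_mul_radial hm, integral_toSphere_inner_pow hm]
  by_cases hp : Even p
  · obtain ⟨q, rfl⟩ := even_iff_exists_two_mul.mp hp
    have hm' : (0 : ℝ) < m := by exact_mod_cast hm
    have hmass := sphereMass_mul hm
    have hpi : Real.sqrt Real.pi ^ m = Real.pi ^ ((m : ℝ) / 2) := by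
      rw [Real.sqrt_eq_rpow, ← Real.rpow_natCast, ← Real.rpow_mul Real.pi_pos.le]
      congr 1
      ring
    rw [hpi] at hmass
    rw [integral_Ioi_pow_mul_ballProfile hm hκ hR, ← hmass, radialMoment, radialMoment,
      if_pos hp, if_pos hp, show 2 * q / 2 = q by omega, Gamma_add_natCast (by positivity),
      Gamma_add_natCast (by positivity)]
    have h1 := (sphereMass_pos hm).ne'
    have h2 := (rising_pos (x := (m : ℝ) / 2) (by positivity) q).ne'
    have h3 := (rising_pos (x := κ + (m : ℝ) / 2) (by positivity) q).ne'
    have h4 := (Real.Gamma_pos_of_pos (s := (m : ℝ) / 2) (by positivity)).ne'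
    have h5 := (Real.Gamma_pos_of_pos (s := κ + (m : ℝ) / 2) (by positivity)).ne'
    field_simp
  · simp [radialMoment, hp]

/-! ### The law given the number of changes of direction -/

/-- The characteristic function of a law on a ball is the sum of its moment series. -/
lemma hasSum_charFun {m : ℕ} {R : ℝ} (μ : Measure (EuclideanSpace ℝ (Fin m))) [IsFiniteMeasure μ]
    (f : EuclideanSpace ℝ (Fin m)) (hμ : ∀ᵐ x ∂μ, |inner ℝ f x| ≤ R) :
    HasSum (fun p : ℕ => ((∫ x, inner ℝ f x ^ p ∂μ : ℝ) : ℂ) * (Complex.I ^ p / p.factorial))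
      (charFun μ f) := by
  have h : HasSum (fun p : ℕ => ∫ x, (((inner ℝ f x ^ p : ℝ) : ℂ) *
      (Complex.I ^ p / p.factorial)) ∂μ) (∫ x, Complex.exp (inner ℝ x f * Complex.I) ∂μ) := by
    refine hasSum_integral_of_dominated_convergence (fun p _ => R ^ p / p.factorial) ?_ ?_ ?_ ?_ ?_
    · intro p
      fun_prop
    · intro p
      filter_upwards [hμ] with x hx
      rw [norm_mul, norm_div, norm_pow, Complex.norm_I, one_pow, Complex.norm_real, norm_pow,
        Real.norm_eq_abs, Complex.norm_natCast, mul_one_div]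
      gcongr
    · exact ae_of_all _ fun _ => Real.summable_pow_div_factorial R
    · exact integrable_const _
    · refine ae_of_all _ fun x => ?_
      have h := NormedSpace.expSeries_div_hasSum_exp (𝔸 := ℂ) (inner ℝ x f * Complex.I)
      rw [← Complex.exp_eq_exp_ℂ] at h
      have heq : ∀ p : ℕ, ((inner ℝ f x ^ p : ℝ) : ℂ) * (Complex.I ^ p / p.factorial) =
          ((inner ℝ x f : ℝ) * Complex.I) ^ p / p.factorial := by
        intro p
        rw [real_inner_comm, mul_pow, Complex.ofReal_pow, mul_div_assoc]
      simp only [heq]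
      exact h
  rw [charFun_apply]
  convert h using 2 with p
  rw [integral_mul_const, integral_complex_ofReal]

/-- A bounded law is determined by the moments of all linear forms. -/
lemma ext_of_moments {m : ℕ} {R : EuclideanSpace ℝ (Fin m) → ℝ}
    {μ ν : Measure (EuclideanSpace ℝ (Fin m))} [IsFiniteMeasure μ] [IsFiniteMeasure ν]
    (hμ : ∀ f, ∀ᵐ x ∂μ, |inner ℝ f x| ≤ R f) (hν : ∀ f, ∀ᵐ x ∂ν, |inner ℝ f x| ≤ R f)
    (h : ∀ (f : EuclideanSpace ℝ (Fin m)) (p : ℕ),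
      ∫ x, inner ℝ f x ^ p ∂μ = ∫ x, inner ℝ f x ^ p ∂ν) : μ = ν := by
  refine Measure.ext_of_charFun (funext fun f => ?_)
  refine (hasSum_charFun μ f (hμ f)).unique ?_
  simp only [h]
  exact hasSum_charFun ν f (hν f)

@[fun_prop]
lemma measurable_projFirst {d m : ℕ} (h : m ≤ d) : Measurable (projFirst h) := by
  unfold projFirst
  fun_prop

/-- The vector `g` is `f` extended by zeros. -/
lemma exists_inner_projFirst {d m : ℕ} (h : m ≤ d) (f : EuclideanSpace ℝ (Fin m)) :
    ∃ g : EuclideanSpace ℝ (Fin d), ‖g‖ = ‖f‖ ∧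
      ∀ x, inner ℝ f (projFirst h x) = inner ℝ g x := by
  let g : EuclideanSpace ℝ (Fin d) :=
    ∑ i, f i • EuclideanSpace.single (Fin.castLE h i) (1 : ℝ)
  have hg : ∀ x, inner ℝ f (projFirst h x) = inner ℝ g x := by
    intro x
    simp only [g, sum_inner, inner_smul_left, EuclideanSpace.inner_single_left]
    simp [projFirst, PiLp.inner_apply, mul_comm]
  have hpg : projFirst h g = f := by
    ext i
    simp [projFirst, g, (Fin.castLE_injective h).eq_iff, Pi.single_apply]
  refine ⟨g, ?_, hg⟩
  have := hg g
  rw [hpg, real_inner_self_eq_norm_sq, real_inner_self_eq_norm_sq] at this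
  exact ((sq_eq_sq₀ (norm_nonneg _) (norm_nonneg _)).1 this).symm

/-- The law on `ℝᵐ` with the Beta type density on the ball of radius `R`. -/
def ballMeasure (m : ℕ) (κ R : ℝ) : Measure (EuclideanSpace ℝ (Fin m)) :=
  volume.withDensity fun x => ENNReal.ofReal (ballProfile m κ R ‖x‖)

lemma integral_ballMeasure_inner_pow {m : ℕ} (hm : 0 < m) {κ R : ℝ} (hκ : 0 < κ) (hR : 0 < R)
    (f : EuclideanSpace ℝ (Fin m)) (p : ℕ) :
    ∫ x, inner ℝ f x ^ p ∂ballMeasure m κ R =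
      R ^ p * (‖f‖ ^ p * radialMoment (κ + m / 2) p) := by
  rw [ballMeasure, integral_withDensity_eq_integral_toReal_smul (by fun_prop)
    (ae_of_all _ fun _ => ENNReal.ofReal_lt_top), ← integral_inner_pow_mul_ballProfile hm hκ hR]
  refine integral_congr_ae (ae_of_all _ fun x => ?_)
  dsimp only
  rw [ENNReal.toReal_ofReal (ballProfile_nonneg m hκ hR (norm_nonneg _)), smul_eq_mul, mul_comm]

lemma isProbabilityMeasure_ballMeasure {m : ℕ} (hm : 0 < m) {κ R : ℝ} (hκ : 0 < κ) (hR : 0 < R) :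
    IsProbabilityMeasure (ballMeasure m κ R) := by
  have h := integral_ballMeasure_inner_pow hm hκ hR 0 0
  simp [rising, radialMoment] at h
  constructor
  rwa [← ENNReal.toReal_eq_one_iff]

lemma ae_ballMeasure_inner_le (m : ℕ) (κ R : ℝ) (f : EuclideanSpace ℝ (Fin m)) :
    ∀ᵐ x ∂ballMeasure m κ R, |inner ℝ f x| ≤ ‖f‖ * R := by
  rw [ballMeasure, ae_withDensity_iff (by fun_prop)]
  refine ae_of_all _ fun x hx => (abs_real_inner_le_norm f x).trans ?_
  gcongr
  by_contra h
  simp [ballProfile, (not_le.1 h).le] at hx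

/-- The end point in `ℝᵈ` of a path with speed `c`, the durations `allSteps t s` and the
directions `v`. -/
def pathEnd {d n : ℕ} (c t : ℝ) (s : Fin n → ℝ)
    (v : Fin (n + 1) → Metric.sphere (0 : EuclideanSpace ℝ (Fin d)) 1) :
    EuclideanSpace ℝ (Fin d) :=
  c • ∑ j, allSteps t s j • (v j : EuclideanSpace ℝ (Fin d))

lemma measurable_pathEnd (d n : ℕ) (c t : ℝ) :
    Measurable fun z : (Fin n → ℝ) × (Fin (n + 1) →
      Metric.sphere (0 : EuclideanSpace ℝ (Fin d)) 1) => pathEnd c t z.1 z.2 := by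
  have h1 : ∀ j : Fin (n + 1), Measurable fun z : (Fin n → ℝ) × (Fin (n + 1) →
      Metric.sphere (0 : EuclideanSpace ℝ (Fin d)) 1) => allSteps t z.1 j := fun j =>
    (measurable_pi_apply j).comp ((measurable_allSteps n t).comp measurable_fst)
  have h2 : ∀ j : Fin (n + 1), Measurable fun z : (Fin n → ℝ) × (Fin (n + 1) →
      Metric.sphere (0 : EuclideanSpace ℝ (Fin d)) 1) => (z.2 j : EuclideanSpace ℝ (Fin d)) :=
    fun j => measurable_subtype_coe.comp ((measurable_pi_apply j).comp measurable_snd)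
  unfold pathEnd
  fun_prop

lemma inner_pathEnd {d n : ℕ} (c t : ℝ) (s : Fin n → ℝ)
    (v : Fin (n + 1) → Metric.sphere (0 : EuclideanSpace ℝ (Fin d)) 1)
    (g : EuclideanSpace ℝ (Fin d)) :
    inner ℝ g (pathEnd c t s v) =
      c * ∑ j, allSteps t s j * inner ℝ g (v j : EuclideanSpace ℝ (Fin d)) := by
  simp [pathEnd, inner_smul_right, inner_sum]

lemma abs_inner_pathEnd_le {d n : ℕ} {c t : ℝ} (hc : 0 ≤ c) {s : Fin n → ℝ}
    (hs : (∀ j, 0 < s j) ∧ ∑ j, s j < t)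
    (v : Fin (n + 1) → Metric.sphere (0 : EuclideanSpace ℝ (Fin d)) 1)
    (g : EuclideanSpace ℝ (Fin d)) :
    |inner ℝ g (pathEnd c t s v)| ≤ ‖g‖ * (c * t) := by
  refine (abs_real_inner_le_norm _ _).trans ?_
  gcongr
  rw [pathEnd, norm_smul, Real.norm_of_nonneg hc]
  gcongr
  have hnonneg : ∀ j, 0 ≤ allSteps t s j := by
    intro j
    refine Fin.lastCases ?_ (fun i => ?_) j
    · simpa using hs.2.le
    · simpa using (hs.1 i).le
  calc ‖∑ j, allSteps t s j • (v j : EuclideanSpace ℝ (Fin d))‖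
      ≤ ∑ j, ‖allSteps t s j • (v j : EuclideanSpace ℝ (Fin d))‖ := norm_sum_le _ _
    _ = ∑ j, allSteps t s j := by
        refine Finset.sum_congr rfl fun j _ => ?_
        rw [norm_smul, Real.norm_of_nonneg (hnonneg j), norm_eq_of_mem_sphere, mul_one]
    _ = t := by simp [Fin.sum_univ_castSucc]

lemma integrable_uniformSphere_inner_pow {d : ℕ} (hd : 0 < d) (n : ℕ)
    (g : EuclideanSpace ℝ (Fin d)) (k : Fin (n + 1) → ℕ) :
    Integrable (fun v : Fin (n + 1) → Metric.sphere (0 : EuclideanSpace ℝ (Fin d)) 1 =>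
      ∏ j, inner ℝ g (v j : EuclideanSpace ℝ (Fin d)) ^ k j)
      (Measure.pi fun _ => uniformSphere d) := by
  have := isProbabilityMeasure_uniformSphere hd
  refine Integrable.fintype_prod
    (f := fun j (v : Metric.sphere (0 : EuclideanSpace ℝ (Fin d)) 1) =>
      inner ℝ g (v : EuclideanSpace ℝ (Fin d)) ^ k j) fun j => ?_
  refine Integrable.of_bound (C := ‖g‖ ^ k j) ?_ (ae_of_all _ fun v => ?_)
  · exact Continuous.aestronglyMeasurable (by fun_prop)
  · rw [norm_pow]
    gcongr
    simpa using norm_inner_le_norm (𝕜 := ℝ) g (v : EuclideanSpace ℝ (Fin d))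

/-- The moments of the end point, computed from the multinomial expansion: the Dirichlet moments
turn it into a coefficient of a product of generating functions. -/
lemma integral_inner_pathEnd_pow {δ : ℝ → ℝ} (hδ : IsDirichletSemigroup δ) {d : ℕ} (hd : 0 < d)
    {a c t : ℝ} (ha : 0 < a) (ht : 0 < t) (hδa : δ a = d / 2) (n : ℕ)
    (g : EuclideanSpace ℝ (Fin d)) (p : ℕ) :
    ∫ z, inner ℝ g (pathEnd c t z.1 z.2) ^ p
        ∂(dirichletSteps a t n).prod (Measure.pi fun _ : Fin (n + 1) => uniformSphere d) =
      (c * t) ^ p * (‖g‖ ^ p * radialMoment (δ ((n + 1) * a)) p) := by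
  have := isProbabilityMeasure_uniformSphere hd
  have := isProbabilityMeasure_dirichletSteps ha ht n
  have hexp : ∀ z : (Fin n → ℝ) × (Fin (n + 1) → Metric.sphere (0 : EuclideanSpace ℝ (Fin d)) 1),
      inner ℝ g (pathEnd c t z.1 z.2) ^ p =
      ∑ k ∈ Finset.piAntidiag (Finset.univ : Finset (Fin (n + 1))) p,
        (c ^ p * Nat.multinomial Finset.univ k) *
          ((∏ j, allSteps t z.1 j ^ k j) *
            ∏ j, inner ℝ g (z.2 j : EuclideanSpace ℝ (Fin d)) ^ k j) := by
    intro z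
    rw [inner_pathEnd, mul_pow, Finset.sum_pow_eq_sum_piAntidiag, Finset.mul_sum]
    refine Finset.sum_congr rfl fun k _ => ?_
    simp only [mul_pow]
    rw [Finset.prod_mul_distrib, mul_assoc]
  have hA : 0 < rising ((n + 1) * a) p := rising_pos (by positivity) p
  simp only [hexp]
  rw [integral_finsetSum]
  · have hterm : ∀ k ∈ Finset.piAntidiag (Finset.univ : Finset (Fin (n + 1))) p,
        ∫ z, (c ^ p * Nat.multinomial Finset.univ k) * ((∏ j, allSteps t z.1 j ^ k j) *
            ∏ j, inner ℝ g (z.2 j : EuclideanSpace ℝ (Fin d)) ^ k j)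
          ∂(dirichletSteps a t n).prod (Measure.pi fun _ : Fin (n + 1) => uniformSphere d) =
        (c * t) ^ p * ‖g‖ ^ p * (p.factorial / rising ((n + 1) * a) p) *
          ∏ j, dirichletCoeff a (δ a) (k j) := by
      intro k hk
      have hsum : ∑ j, k j = p := by simpa using hk
      rw [integral_const_mul, integral_prod_mul (fun s => ∏ j, allSteps t s j ^ k j)
        (fun v : Fin (n + 1) → Metric.sphere (0 : EuclideanSpace ℝ (Fin d)) 1 =>
          ∏ j, inner ℝ g (v j : EuclideanSpace ℝ (Fin d)) ^ k j),
        integral_dirichletSteps ha ht, integral_fintype_prod_eq_prod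
          (f := fun j (v : Metric.sphere (0 : EuclideanSpace ℝ (Fin d)) 1) =>
            inner ℝ g (v : EuclideanSpace ℝ (Fin d)) ^ k j), hsum]
      simp only [integral_uniformSphere_inner_pow hd, dirichletCoeff, hδa]
      rw [Finset.prod_mul_distrib, Finset.prod_mul_distrib, Finset.prod_div_distrib,
        Finset.prod_pow_eq_pow_sum, hsum]
      have hmul : (∏ j, ((k j).factorial : ℝ)) * Nat.multinomial Finset.univ k = p.factorial := by
        rw [← hsum]
        exact_mod_cast Nat.multinomial_spec Finset.univ k
      have hfac : (∏ j, ((k j).factorial : ℝ)) ≠ 0 :=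
        Finset.prod_ne_zero_iff.2 fun j _ => by positivity
      rw [← hmul, mul_pow]
      field_simp
    rw [Finset.sum_congr rfl hterm, ← Finset.mul_sum, hδ.sum_piAntidiag ha, dirichletCoeff]
    have : (p.factorial : ℝ) ≠ 0 := by positivity
    field_simp
  · intro k _
    exact (Integrable.mul_prod (integrable_dirichletSteps ha ht n k)
      (integrable_uniformSphere_inner_pow hd n g k)).const_mul _

/-- Given `n` changes of direction, the projection onto `ℝᵐ` has a Beta type law on the ball. -/
lemma map_projFirst_pathEnd {δ : ℝ → ℝ} (hδ : IsDirichletSemigroup δ) {d m : ℕ} (hm : 0 < m)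
    (hmd : m ≤ d) {a c t κ : ℝ} (ha : 0 < a) (hc : 0 < c) (ht : 0 < t) (hκ : 0 < κ)
    (hδa : δ a = d / 2) (n : ℕ) (hδn : δ ((n + 1) * a) = κ + m / 2) :
    ((dirichletSteps a t n).prod (Measure.pi fun _ : Fin (n + 1) => uniformSphere d)).map
      (fun z => projFirst hmd (pathEnd c t z.1 z.2)) = ballMeasure m κ (c * t) := by
  have hd : 0 < d := hm.trans_le hmd
  have := isProbabilityMeasure_uniformSphere hd
  have := isProbabilityMeasure_dirichletSteps ha ht n
  have := isProbabilityMeasure_ballMeasure hm hκ (mul_pos hc ht)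
  have hmeas : Measurable fun z : (Fin n → ℝ) × (Fin (n + 1) →
      Metric.sphere (0 : EuclideanSpace ℝ (Fin d)) 1) => projFirst hmd (pathEnd c t z.1 z.2) :=
    (measurable_projFirst hmd).comp (measurable_pathEnd d n c t)
  refine ext_of_moments (R := fun f => ‖f‖ * (c * t)) (fun f => ?_)
    (ae_ballMeasure_inner_le m κ _) fun f p => ?_
  · obtain ⟨g, hgf, hg⟩ := exists_inner_projFirst hmd f
    rw [ae_map_iff hmeas.aemeasurable (measurableSet_le (by fun_prop) measurable_const)]
    have h1 := Measure.quasiMeasurePreserving_fst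
      (μ := dirichletSteps a t n) (ν := Measure.pi fun _ : Fin (n + 1) => uniformSphere d)
      |>.ae (ae_dirichletSteps a t n)
    filter_upwards [h1] with z hz
    rw [hg, ← hgf]
    exact abs_inner_pathEnd_le hc.le hz _ _
  · obtain ⟨g, hgf, hg⟩ := exists_inner_projFirst hmd f
    rw [integral_map hmeas.aemeasurable (Continuous.aestronglyMeasurable (by fun_prop)),
      integral_ballMeasure_inner_pow hm hκ (mul_pos hc ht)]
    simp only [hg]
    rw [integral_inner_pathEnd_pow hδ hd ha ht hδa, hδn, hgf]

/-! ### Mixing over the number of changes of direction -/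

/-- The common form of `projDensityX` (with `α = (d - 1) / 2`) and `projDensityY`
(with `α = d / 2 - 1`). -/
def mittagLefflerDensity (d m : ℕ) (α c t l : ℝ) (x : EuclideanSpace ℝ (Fin m)) : ℝ :=
  open scoped Classical in
  if ‖x‖ < c * t then
    (c ^ 2 * t ^ 2 - ‖x‖ ^ 2) ^ (((d : ℝ) - m) / 2 - 1) /
        (Real.pi ^ ((m : ℝ) / 2) * (c * t) ^ ((d : ℝ) - 2)) *
      (mittagLeffler α (((d : ℝ) - m) / 2)
          (l * t * (c ^ 2 * t ^ 2 - ‖x‖ ^ 2) ^ α / (c * t) ^ (2 * α)) /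
        mittagLeffler α ((d : ℝ) / 2) (l * t))
  else 0

lemma fracPoissonProb_nonneg {α β l t : ℝ} (hα : 0 ≤ α) (hβ : 0 < β) (hl : 0 ≤ l) (ht : 0 ≤ t)
    (n : ℕ) : 0 ≤ fracPoissonProb α β l t n := by
  have h : ∀ k : ℕ, 0 ≤ (l * t) ^ k / Real.Gamma (α * k + β) := fun k => by positivity
  exact mul_nonneg (one_div_nonneg.2 (tsum_nonneg h)) (h n)

/-- Mixing the Beta type densities with the fractional Poisson weights sums up to a quotient of
Mittag-Leffler functions, because the Gamma factors `Γ (α n + d / 2)` cancel. -/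
lemma tsum_fracPoissonProb_mul_ballProfile (d m : ℕ) {α c t l : ℝ} (hα : 0 < α) (hd : 0 < d)
    (hc : 0 < c) (ht : 0 < t) (x : EuclideanSpace ℝ (Fin m)) :
    ∑' n, fracPoissonProb α ((d : ℝ) / 2) l t n *
        ballProfile m (α * n + ((d : ℝ) - m) / 2) (c * t) ‖x‖ =
      mittagLefflerDensity d m α c t l x := by
  unfold mittagLefflerDensity
  split_ifs with h
  · have hR : 0 < c * t := mul_pos hc ht
    have hw : 0 < c ^ 2 * t ^ 2 - ‖x‖ ^ 2 := by
      rw [← mul_pow]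
      nlinarith [norm_nonneg x]
    have hd' : (0 : ℝ) < d := by exact_mod_cast hd
    rw [mittagLeffler, ← tsum_div_const, ← tsum_mul_left]
    refine tsum_congr fun n => ?_
    rw [ballProfile, Set.indicator_of_mem (by exact h), fracPoissonProb, mul_pow c t 2,
      show α * n + ((d : ℝ) - m) / 2 + m / 2 = α * n + d / 2 by ring,
      show 2 * (α * n + ((d : ℝ) - m) / 2) + m - 2 = 2 * α * n + (d - 2) by ring,
      show α * n + ((d : ℝ) - m) / 2 - 1 = α * n + (((d : ℝ) - m) / 2 - 1) by ring,
      Real.rpow_add hR, Real.rpow_add hw, Real.rpow_mul hR.le, Real.rpow_mul hw.le,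
      Real.rpow_natCast, Real.rpow_natCast, div_pow, mul_pow _ _ n]
    have h1 : Real.Gamma (α * n + d / 2) ≠ 0 := (Real.Gamma_pos_of_pos (by positivity)).ne'
    have h2 := (Real.rpow_pos_of_pos hR (2 * α)).ne'
    have h3 := (Real.rpow_pos_of_pos hR ((d : ℝ) - 2)).ne'
    field_simp
    ring
  · simp [ballProfile, h]

lemma flightPosition_eq_pathEnd {Ω : Type*} {d : ℕ} (c t : ℝ) (N : Ω → ℕ) (τ : ℕ → Ω → ℝ)
    (V : ℕ → Ω → Metric.sphere (0 : EuclideanSpace ℝ (Fin d)) 1) (ω : Ω) :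
    flightPosition c t N τ V ω =
      pathEnd c t (fun j : Fin (N ω) => τ j ω) (fun j : Fin (N ω + 1) => V j ω) := by
  rw [flightPosition, pathEnd, Finset.sum_range, Fin.sum_univ_castSucc, Fin.sum_univ_castSucc]
  simp [stepDuration, Finset.sum_range]

lemma measurable_indexed {Ω E : Type*} [MeasurableSpace Ω] [MeasurableSpace E] {N : Ω → ℕ}
    (hN : Measurable N) {X : ℕ → Ω → E} (hX : ∀ n, Measurable (X n)) :
    Measurable fun ω => X (N ω) ω :=
  (measurable_from_prod_countable_right (f := fun z : ℕ × Ω => X z.1 z.2) hX).comp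
    (hN.prodMk measurable_id)

/-- The law of `X_N`, for a random index `N`, is the mixture of the conditional laws of `X_n` given
`N = n`. -/
lemma map_eq_sum_map_cond {Ω E : Type*} [MeasurableSpace Ω] [MeasurableSpace E] (P : Measure Ω)
    [IsFiniteMeasure P] {N : Ω → ℕ} (hN : Measurable N) {X : ℕ → Ω → E}
    (hX : ∀ n, Measurable (X n)) :
    P.map (fun ω => X (N ω) ω) =
      Measure.sum fun n => P (N ⁻¹' {n}) • (ProbabilityTheory.cond P (N ⁻¹' {n})).map (X n) := by
  have hmeas := measurable_indexed hN hX
  have hNn : ∀ n, MeasurableSet (N ⁻¹' {n}) := fun n => hN (measurableSet_singleton n)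
  ext B hB
  rw [Measure.map_apply hmeas hB, Measure.sum_apply _ hB]
  have hunion : (fun ω => X (N ω) ω) ⁻¹' B = ⋃ n, N ⁻¹' {n} ∩ X n ⁻¹' B := by
    ext ω
    simp
  rw [hunion, measure_iUnion]
  · refine tsum_congr fun n => ?_
    rw [← cond_mul_eq_inter (hNn n), Measure.smul_apply, smul_eq_mul, Measure.map_apply (hX n) hB,
      mul_comm]
  · intro i j hij
    refine Set.disjoint_left.2 fun ω hi hj => hij ?_
    have h1 : N ω = i := hi.1
    have h2 : N ω = j := hj.1
    exact h1.symm.trans h2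
  · exact fun n => (hNn n).inter (hX n hB)

lemma measurable_projFirst_pathEnd {d m : ℕ} (hmd : m ≤ d) (n : ℕ) (c t : ℝ) :
    Measurable fun z : (Fin n → ℝ) × (Fin (n + 1) →
      Metric.sphere (0 : EuclideanSpace ℝ (Fin d)) 1) => projFirst hmd (pathEnd c t z.1 z.2) :=
  (measurable_projFirst hmd).comp (measurable_pathEnd d n c t)

lemma IsRandomFlight.measurable_path {Ω : Type*} [MeasurableSpace Ω] {P : Measure Ω}
    {d : ℕ} {a t : ℝ} {p : ℕ → ℝ} {N : Ω → ℕ} {τ : ℕ → Ω → ℝ}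
    {V : ℕ → Ω → Metric.sphere (0 : EuclideanSpace ℝ (Fin d)) 1}
    (h : IsRandomFlight P d a t p N τ V) (n : ℕ) :
    Measurable fun ω => ((fun j : Fin n => τ j ω), (fun j : Fin (n + 1) => V j ω)) :=
  (measurable_pi_iff.2 fun j : Fin n => h.measurable_duration j).prodMk
    (measurable_pi_iff.2 fun j : Fin (n + 1) => h.measurable_direction j)

lemma IsRandomFlight.measurable_projFirst_pathEnd {Ω : Type*} [MeasurableSpace Ω] {P : Measure Ω}
    {d : ℕ} {a t : ℝ} {p : ℕ → ℝ} {N : Ω → ℕ} {τ : ℕ → Ω → ℝ}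
    {V : ℕ → Ω → Metric.sphere (0 : EuclideanSpace ℝ (Fin d)) 1}
    (h : IsRandomFlight P d a t p N τ V) (c : ℝ) {m : ℕ} (hmd : m ≤ d) (n : ℕ) :
    Measurable fun ω => projFirst hmd
      (pathEnd c t (fun j : Fin n => τ j ω) (fun j : Fin (n + 1) => V j ω)) := by
  have h1 := (_root_.measurable_projFirst_pathEnd hmd n c t).comp (h.measurable_path n)
  simpa only [Function.comp_def] using h1

lemma projFirst_flightPosition_eq {Ω : Type*} {d m : ℕ} (hmd : m ≤ d) (c t : ℝ) (N : Ω → ℕ)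
    (τ : ℕ → Ω → ℝ) (V : ℕ → Ω → Metric.sphere (0 : EuclideanSpace ℝ (Fin d)) 1) :
    (fun ω => projFirst hmd (flightPosition c t N τ V ω)) =
      fun ω => (fun n ω => projFirst hmd (pathEnd c t (fun j : Fin n => τ j ω)
        (fun j : Fin (n + 1) => V j ω))) (N ω) ω := by
  funext ω
  rw [flightPosition_eq_pathEnd]

lemma IsRandomFlight.measurable_projFirst {Ω : Type*} [MeasurableSpace Ω] {P : Measure Ω}
    {d : ℕ} {a t : ℝ} {p : ℕ → ℝ} {N : Ω → ℕ} {τ : ℕ → Ω → ℝ}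
    {V : ℕ → Ω → Metric.sphere (0 : EuclideanSpace ℝ (Fin d)) 1}
    (h : IsRandomFlight P d a t p N τ V) (c : ℝ) {m : ℕ} (hmd : m ≤ d) :
    Measurable (fun ω => projFirst hmd (flightPosition c t N τ V ω)) := by
  rw [projFirst_flightPosition_eq]
  exact measurable_indexed h.measurable_number (h.measurable_projFirst_pathEnd c hmd)

/-- The law of a random flight is the mixture, with respect to the number of changes of direction,
of the laws of its paths with a given number of changes of direction. -/
lemma IsRandomFlight.map_eq_sum {Ω : Type*} [MeasurableSpace Ω] {P : Measure Ω}
    [IsFiniteMeasure P] {d : ℕ} {a t : ℝ} {p : ℕ → ℝ} {N : Ω → ℕ} {τ : ℕ → Ω → ℝ}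
    {V : ℕ → Ω → Metric.sphere (0 : EuclideanSpace ℝ (Fin d)) 1}
    (h : IsRandomFlight P d a t p N τ V) (c : ℝ) {m : ℕ} (hmd : m ≤ d) :
    P.map (fun ω => projFirst hmd (flightPosition c t N τ V ω)) =
      Measure.sum fun n => ENNReal.ofReal (p n) •
        ((dirichletSteps a t n).prod (Measure.pi fun _ : Fin (n + 1) => uniformSphere d)).map
          (fun z => projFirst hmd (pathEnd c t z.1 z.2)) := by
  rw [projFirst_flightPosition_eq, map_eq_sum_map_cond P h.measurable_number
    (h.measurable_projFirst_pathEnd c hmd)]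
  congr 1
  funext n
  rw [h.number_law, ← h.conditional_law n,
    Measure.map_map (_root_.measurable_projFirst_pathEnd hmd n c t) (h.measurable_path n)]
  simp only [Function.comp_def]

/-- The law of the projection of a flight for which the generating functions form a semigroup. -/
theorem IsRandomFlight.hasLaw_projFirst {Ω : Type*} [MeasurableSpace Ω] {P : Measure Ω}
    [IsProbabilityMeasure P] {δ : ℝ → ℝ} (hδ : IsDirichletSemigroup δ) {d m : ℕ} (hm : 0 < m)
    (hmd : m < d) {a α c t l : ℝ} (ha : 0 < a) (hα : 0 < α) (hc : 0 < c) (ht : 0 < t) (hl : 0 < l)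
    (hδa : ∀ n : ℕ, δ ((n + 1) * a) = α * n + d / 2) {N : Ω → ℕ} {τ : ℕ → Ω → ℝ}
    {V : ℕ → Ω → Metric.sphere (0 : EuclideanSpace ℝ (Fin d)) 1}
    (h : IsRandomFlight P d a t (fracPoissonProb α ((d : ℝ) / 2) l t) N τ V) :
    HasLaw (fun ω => projFirst hmd.le (flightPosition c t N τ V ω))
      (volume.withDensity fun x => ENNReal.ofReal (mittagLefflerDensity d m α c t l x)) P := by
  have hmeas := h.measurable_projFirst c hmd.le
  refine ⟨hmeas.aemeasurable, ?_⟩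
  have hd : 0 < d := hm.trans hmd
  have hd' : (0 : ℝ) < d := by exact_mod_cast hd
  have hR : 0 < c * t := mul_pos hc ht
  have hκ : ∀ n : ℕ, 0 < α * n + ((d : ℝ) - m) / 2 := by
    intro n
    have : (0 : ℝ) < d - m := sub_pos.2 (by exact_mod_cast hmd)
    positivity
  have hδ0 : δ a = d / 2 := by simpa using hδa 0
  set p := fracPoissonProb α ((d : ℝ) / 2) l t with hp
  have hp0 : ∀ n, 0 ≤ p n := fracPoissonProb_nonneg hα.le (by positivity) hl.le ht.le
  let ρ : ℕ → EuclideanSpace ℝ (Fin m) → ℝ := fun n x =>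
    p n * ballProfile m (α * n + ((d : ℝ) - m) / 2) (c * t) ‖x‖
  have hρ0 : ∀ n x, 0 ≤ ρ n x := fun n x =>
    mul_nonneg (hp0 n) (ballProfile_nonneg m (hκ n) hR (norm_nonneg x))
  have hρm : ∀ n, Measurable fun x => ENNReal.ofReal (ρ n x) := fun n => by fun_prop
  have hsum : P.map (fun ω => projFirst hmd.le (flightPosition c t N τ V ω)) =
      volume.withDensity (∑' n, fun x => ENNReal.ofReal (ρ n x)) := by
    rw [h.map_eq_sum c hmd.le, withDensity_tsum hρm]
    congr 1
    ext1 n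
    rw [map_projFirst_pathEnd hδ hm hmd.le ha hc ht (hκ n) hδ0 n (by rw [hδa]; ring), ballMeasure,
      ← withDensity_smul _ (by fun_prop)]
    congr 1
    ext1 x
    simp only [Pi.smul_apply, smul_eq_mul, ρ]
    rw [ENNReal.ofReal_mul (hp0 n)]
  rw [hsum]
  have happ : ∀ x, (∑' n, fun x => ENNReal.ofReal (ρ n x)) x = ∑' n, ENNReal.ofReal (ρ n x) :=
    fun x => tsum_apply (Pi.summable.2 fun _ => ENNReal.summable)
  refine withDensity_congr_ae ?_
  -- The mixture has total mass one, so that the series of densities converges almost everywhere.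
  have hfin : ∫⁻ x, (∑' n, fun x => ENNReal.ofReal (ρ n x)) x ≠ ⊤ := by
    rw [← setLIntegral_univ, ← withDensity_apply _ MeasurableSet.univ, ← hsum]
    have := Measure.isProbabilityMeasure_map (μ := P) hmeas.aemeasurable
    exact measure_ne_top _ _
  rw [funext happ] at hfin
  have hlt := ae_lt_top (Measurable.tsum hρm) hfin
  filter_upwards [hlt] with x hx
  rw [happ]
  have hsummable : Summable fun n => ρ n x := by
    have := ENNReal.summable_toReal hx.ne
    simpa only [ENNReal.toReal_ofReal (hρ0 _ x)] using this
  rw [← ENNReal.ofReal_tsum_of_nonneg (fun n => hρ0 n x) hsummable,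
    ← tsum_fracPoissonProb_mul_ballProfile d m hα hd hc ht x]

end

theorem theorem6 {Ω : Type*} [MeasurableSpace Ω] (P : Measure Ω) [IsProbabilityMeasure P]
    (d m : ℕ) (hm : 1 ≤ m) (hmd : m < d)
    (c t l : ℝ) (hc : 0 < c) (ht : 0 < t) (hl : 0 < l) :
    (∀ (N : Ω → ℕ) (τ : ℕ → Ω → ℝ)
        (V : ℕ → Ω → Metric.sphere (0 : EuclideanSpace ℝ (Fin d)) 1),
      IsRandomFlight P d ((d : ℝ) - 1) t
          (fracPoissonProb (((d : ℝ) - 1) / 2) ((d : ℝ) / 2) l t) N τ V →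
        HasLaw (fun ω => projFirst hmd.le (flightPosition c t N τ V ω))
          ((volume : Measure (EuclideanSpace ℝ (Fin m))).withDensity
            fun x => ENNReal.ofReal (projDensityX d m c t l x)) P) ∧
    (3 ≤ d → ∀ (M : Ω → ℕ) (τ : ℕ → Ω → ℝ)
        (V : ℕ → Ω → Metric.sphere (0 : EuclideanSpace ℝ (Fin d)) 1),
      IsRandomFlight P d ((d : ℝ) / 2 - 1) t
          (fracPoissonProb ((d : ℝ) / 2 - 1) ((d : ℝ) / 2) l t) M τ V →
        HasLaw (fun ω => projFirst hmd.le (flightPosition c t M τ V ω))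
          ((volume : Measure (EuclideanSpace ℝ (Fin m))).withDensity
            fun y => ENNReal.ofReal (projDensityY d m c t l y)) P) := by
  have hd2 : (2 : ℝ) ≤ d := by exact_mod_cast (by omega : 2 ≤ d)
  refine ⟨fun N τ V h => ?_, fun hd3 N τ V h => ?_⟩
  · have := h.hasLaw_projFirst isDirichletSemigroup_half hm hmd (by linarith) (by linarith) hc ht hl
      (fun n => by ring)
    simpa only [projDensityX, mittagLefflerDensity, mul_div_cancel₀ ((d : ℝ) - 1) two_ne_zero]
      using this
  · have hd3' : (3 : ℝ) ≤ d := by exact_mod_cast hd3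
    have := h.hasLaw_projFirst isDirichletSemigroup_one hm hmd (by linarith) (by linarith) hc ht hl
      (fun n => by ring)
    simpa only [projDensityY, mittagLefflerDensity, show 2 * ((d : ℝ) / 2 - 1) = d - 2 by ring]
      using this
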